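/- Directed sets are nonempty. A dcpo is a poset in which every directed set has a supremum. For elements of a dcpo $D$, $a\ll b$ means: for every directed $S\subseteq D$ with $b\le\sup S$ there is $d\in S$ with $a\le d$; $d$ is compact if $d\ll d$. Let $V$ be an infinite set of nodes and let $L$ be a dcpo with least element $\bot$ in which every element has only finitely many elements below it. In a strict poset $\langle N,<\rangle$ write $\mathrm{succ}(x)$ for the set of immediate successors of $x$. If every element of $N$ has finitely many elements below it, the level of $x$ is the greatest length of a path of immediate successors from a minimal element to $x$. A labelled partial order with formulae (LPOF) over $L$ is a tuple $\alpha=\langle N_\alpha,<_\alpha,\lambda_\alpha,\varphi_\alpha\rangle$ such that: $N_\alpha\subseteq V$ is countable; $<_\alpha$ is a strict partial order on $N_\alpha$ with finitely many elements below each element, finitely many elements on each level, and exactly one minimal element; $\lambda_\alpha\colon N_\alpha\to L$ satisfies $\mathrm{succ}_\alpha(x)=\emptyset$ whenever $\lambda_\alpha(x)=\bot$; and $\varphi_\alpha$ assigns to each node a Boolean formula (built from true, false, $\wedge$, $\vee$, $\neg$ and variables in $V$) such that $\varphi_\alpha(x)$ is satisfiable, its variables lie strictly below $x$, and $\varphi_\alpha(y)$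 entails $\varphi_\alpha(x)$ whenever $x<_\alpha y$. Write $\alpha\sqsubseteq\beta$ if $N_\alpha$ is a downward closed subset of $N_\beta$, $<_\alpha$ is the restriction of $<_\beta$ to $N_\alpha$, and for all $x\in N_\alpha$: $\lambda_\alpha(x)\le\lambda_\beta(x)$, $\varphi_\alpha(x)=\varphi_\beta(x)$, and $\mathrm{succ}_\alpha(x)$ consists of those $y\in\mathrm{succ}_\beta(x)$ for which there is no $z\in N_\alpha$ with $\lambda_\alpha(z)=\bot$ and $z<_\beta y$. Two LPOFs are isomorphic if a bijection between their nodes carries the order, the labels and the formulae (with variables renamed) of one to those of the other. A pomset is an isomorphism class of LPOFs, and $\mathrm{Pom}(L)$ is the set of pomsets. It is ordered by: $A\sqsubseteq B$ iff for every $\beta\in B$ there is $\alpha\in A$ with $\alpha\sqsubseteq\beta$ (equivalently, iff $\alpha\sqsubseteq\beta$ for some $\alpha\in A$ and $\beta\in B$). A pomset is finite if it has finitely many nodes, and a finite approximation of $A$ is a finite pomset $B\sqsubseteq A$. Then: 1. every pomset $A$ is the supremum of the set of its finite approximations; 2. the compact elements of $\mathrm{Pom}(L)$ are exactly the finite pomsets;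 3. for all pomsets $A,B$: $A\ll B$ if and only if $A$ is a finite approximation of $B$; 4. $\mathrm{Pom}(L)$ is an algebraic dcpo: it is a dcpo, and for every pomset $A$ the set of compact elements below $A$ is directed and has supremum $A$. -/

import Mathlib

namespace Pomset

/-! ### Directed-complete partial orders, approximation, compactness -/

section Domain

variable {D : Type*} [LE D]

/-- Nonempty directed subsets. -/
def IsDirectedSet (S : Set D) : Prop :=
  S.Nonempty ∧ DirectedOn (· ≤ ·) S

variable (D) in
/-- `D` is a directed-complete partial order: a poset in which every directed set has a supremum. -/
def IsDcpo : Prop :=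
  IsPartialOrder D (· ≤ ·) ∧ ∀ S : Set D, IsDirectedSet S → ∃ s, IsLUB S s

/-- The approximation (way-below) order. -/
def WayBelow (a b : D) : Prop :=
  ∀ S : Set D, IsDirectedSet S → ∀ s, IsLUB S s → b ≤ s → ∃ d ∈ S, a ≤ d

variable (D) in
/-- The set of compact elements. -/
def compactElements : Set D := {d | WayBelow d d}

variable (D) in
/-- `D` is an algebraic dcpo: each element is the supremum of the directed set of the compact
elements below it. -/
def IsAlgebraicDcpo : Prop :=
  IsDcpo D ∧ ∀ d : D, IsDirectedSet {k ∈ compactElements D | k ≤ d} ∧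
    IsLUB {k ∈ compactElements D | k ≤ d} d

/-- Every element has only finitely many elements strictly below it. -/
def IsFinitelyPreceded (L : Type*) [PartialOrder L] : Prop :=
  ∀ l : L, (Set.Iio l).Finite

end Domain

/-! ### Boolean formulae over nodes -/

/-- Boolean formulae with variables in `V`. -/
inductive Form (V : Type*) where
  | tru : Form V
  | fls : Form V
  | and : Form V → Form V → Form V
  | or : Form V → Form V → Form V
  | not : Form V → Form V
  | var : V → Form V

namespace Form

variable {V W : Type*}

/-- Satisfaction of a formula by a valuation. -/
def Sat (v : V → Bool) : Form V → Prop
  | tru => True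
  | fls => False
  | and p q => Sat v p ∧ Sat v q
  | or p q => Sat v p ∨ Sat v q
  | not p => ¬ Sat v p
  | var x => v x = true

/-- The variables of a formula. -/
def free : Form V → Set V
  | tru => ∅
  | fls => ∅
  | and p q => free p ∪ free q
  | or p q => free p ∪ free q
  | not p => free p
  | var x => {x}

/-- Syntactic renaming of the variables. -/
def map (f : V → W) : Form V → Form W
  | tru => tru
  | fls => fls
  | and p q => and (map f p) (map f q)
  | or p q => or (map f p) (map f q)
  | not p => not (map f p)
  | var x => var (f x)

def Satisfiable (p : Form V) : Prop := ∃ v, Sat v p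

def Entails (p q : Form V) : Prop := ∀ v, Sat v p → Sat v q

theorem map_map {U : Type*} (g : W → U) (f : V → W) (p : Form V) :
    map g (map f p) = map (fun x => g (f x)) p := by
  induction p <;> simp_all [map]

theorem map_congr {f g : V → W} (p : Form V) (h : ∀ x ∈ free p, f x = g x) :
    map f p = map g p := by
  induction p <;> simp_all [map, free]

theorem map_eq_self {f : V → V} (p : Form V) (h : ∀ x ∈ free p, f x = x) : map f p = p := by
  induction p <;> simp_all [map, free]

theorem free_map (f : V → W) (p : Form V) : free (map f p) = f '' free p := by
  induction p <;> simp_all [map, free, Set.image_union]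

theorem sat_map (f : V → W) (v : W → Bool) (p : Form V) :
    Sat v (map f p) ↔ Sat (fun x => v (f x)) p := by
  induction p <;> simp_all [map, Sat]

theorem sat_congr {v w : V → Bool} (p : Form V) (h : ∀ x ∈ free p, v x = w x) :
    Sat v p ↔ Sat w p := by
  induction p <;> simp_all [free, Sat]

end Form

/-! ### Strict posets: a set of nodes `N` with a relation `lt` between elements of `N` -/

section Poset

variable {V : Type*}

/-- All nodes strictly above `x`. -/
def succPlus (lt : V → V → Prop) (x : V) : Set V := {y | lt x y}

/-- All nodes strictly above some element of `X`. -/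
def succPlusSet (lt : V → V → Prop) (X : Set V) : Set V := ⋃ x ∈ X, succPlus lt x

/-- All nodes strictly below `x`. -/
def predPlus (lt : V → V → Prop) (x : V) : Set V := {y | lt y x}

/-- Immediate successors. -/
def succ (lt : V → V → Prop) (x : V) : Set V := {y ∈ succPlus lt x | ¬ ∃ z, lt x z ∧ lt z y}

/-- Immediate predecessors. -/
def pred (lt : V → V → Prop) (x : V) : Set V := {y ∈ predPlus lt x | ¬ ∃ z, lt y z ∧ lt z x}

/-- Minimal nodes. -/
def minNodes (N : Set V) (lt : V → V → Prop) : Set V := {x ∈ N | pred lt x = ∅}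

/-- The level of a node: the greatest length of a path of immediate successors that leads from a
minimal node to `x` (only the entries `s 0, …, s n` of the sequence matter). -/
noncomputable def level (N : Set V) (lt : V → V → Prop) (x : V) : ℕ :=
  sSup {n | ∃ s : ℕ → V, s 0 ∈ minNodes N lt ∧ s n = x ∧ ∀ i < n, s (i + 1) ∈ succ lt (s i)}

/-- `M` is a downward closed subset of the poset `(N, lt)`. -/
def DownClosed (M N : Set V) (lt : V → V → Prop) : Prop :=
  M ⊆ N ∧ ∀ y ∈ M, predPlus lt y ⊆ M

end Poset

/-! ### Labelled partial orders with formulae -/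

/-- Labelled partial orders with formulae over the labels `L`, with nodes in `V`. The labelling and
the formula function are functions on `nodes`; they are represented by total functions that take
the fixed values `⊥` and `tru` outside `nodes`, so that this representation is unique. -/
@[ext]
structure LPOF (V : Type*) (L : Type*) [PartialOrder L] [OrderBot L] where
  nodes : Set V
  lt : V → V → Prop
  label : V → L
  form : V → Form V
  countable_nodes : nodes.Countable
  lt_mem : ∀ x y, lt x y → x ∈ nodes ∧ y ∈ nodes
  lt_irrefl : ∀ x, ¬ lt x x
  lt_trans : ∀ x y z, lt x y → lt y z → lt x z
  finite_predPlus : ∀ x ∈ nodes, (predPlus lt x).Finite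
  finite_level : ∀ n : ℕ, {x ∈ nodes | level nodes lt x = n}.Finite
  single_root : ∃ r, minNodes nodes lt = {r}
  succ_bot : ∀ x ∈ nodes, label x = ⊥ → succ lt x = ∅
  form_sat : ∀ x ∈ nodes, (form x).Satisfiable
  form_free : ∀ x ∈ nodes, (form x).free ⊆ predPlus lt x
  form_entails : ∀ x y, lt x y → (form y).Entails (form x)
  label_outside : ∀ x, x ∉ nodes → label x = ⊥
  form_outside : ∀ x, x ∉ nodes → form x = Form.tru

namespace LPOF

variable {V L : Type*} [PartialOrder L] [OrderBot L]

/-- The nodes labelled `⊥`. -/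
def botNodes (α : LPOF V L) : Set V := {x ∈ α.nodes | α.label x = ⊥}

/-- The order on LPOFs. -/
def Below (α β : LPOF V L) : Prop :=
  DownClosed α.nodes β.nodes β.lt ∧
  (∀ x y, α.lt x y ↔ β.lt x y ∧ x ∈ α.nodes ∧ y ∈ α.nodes) ∧
  ∀ x ∈ α.nodes, α.label x ≤ β.label x ∧ α.form x = β.form x ∧
    succ α.lt x = succ β.lt x \ succPlusSet β.lt α.botNodes

/-- `f` restricts to a bijection between the nodes that carries `α` to `β`. -/
structure IsIso (f : V → V) (α β : LPOF V L) : Prop where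
  bijOn : Set.BijOn f α.nodes β.nodes
  lt_iff : ∀ x ∈ α.nodes, ∀ y ∈ α.nodes, α.lt x y ↔ β.lt (f x) (f y)
  label_eq : ∀ x ∈ α.nodes, β.label (f x) = α.label x
  form_eq : ∀ x ∈ α.nodes, β.form (f x) = (α.form x).map f

/-- Isomorphism of LPOFs. -/
def Iso (α β : LPOF V L) : Prop := ∃ f : V → V, IsIso f α β

theorem free_subset (α : LPOF V L) {x : V} (hx : x ∈ α.nodes) : (α.form x).free ⊆ α.nodes :=
  fun _ hy => (α.lt_mem _ _ (α.form_free x hx hy)).1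

theorem Iso.refl (α : LPOF V L) : Iso α α :=
  ⟨id, Set.bijOn_id _, fun _ _ _ _ => Iff.rfl, fun _ _ => rfl,
    fun _ _ => (Form.map_eq_self _ fun _ _ => rfl).symm⟩

theorem Iso.symm {α β : LPOF V L} : Iso α β → Iso β α := by
  rintro ⟨f, hf⟩
  obtain ⟨r, hr⟩ := α.single_root
  have : Nonempty V := ⟨r⟩
  have hl : Set.LeftInvOn (Function.invFunOn f α.nodes) f α.nodes := hf.bijOn.injOn.leftInvOn_invFunOn
  have hinv : Set.InvOn (Function.invFunOn f α.nodes) f α.nodes β.nodes := hf.bijOn.invOn_invFunOn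
  have hb : Set.BijOn (Function.invFunOn f α.nodes) β.nodes α.nodes :=
    hf.bijOn.symm hinv.symm
  refine ⟨Function.invFunOn f α.nodes, hb, ?_, ?_, ?_⟩
  · intro x hx y hy
    rw [hf.lt_iff _ (hb.mapsTo hx) _ (hb.mapsTo hy), hinv.2 hx, hinv.2 hy]
  · intro x hx
    rw [← hf.label_eq _ (hb.mapsTo hx), hinv.2 hx]
  · intro x hx
    have := hf.form_eq _ (hb.mapsTo hx)
    rw [hinv.2 hx] at this
    rw [this, Form.map_map, Form.map_eq_self]
    intro y hy
    exact hl (α.free_subset (hb.mapsTo hx) hy)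

theorem Iso.trans {α β γ : LPOF V L} : Iso α β → Iso β γ → Iso α γ := by
  rintro ⟨f, hf⟩ ⟨g, hg⟩
  refine ⟨fun x => g (f x), hg.bijOn.comp hf.bijOn, ?_, ?_, ?_⟩
  · intro x hx y hy
    rw [hf.lt_iff x hx y hy, hg.lt_iff _ (hf.bijOn.mapsTo hx) _ (hf.bijOn.mapsTo hy)]
  · intro x hx
    rw [hg.label_eq _ (hf.bijOn.mapsTo hx), hf.label_eq x hx]
  · intro x hx
    rw [hg.form_eq _ (hf.bijOn.mapsTo hx), hf.form_eq x hx, Form.map_map]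

end LPOF

/-! ### Pomsets -/

/-- Isomorphism of LPOFs as a setoid. -/
instance LPOF.setoid (V L : Type*) [PartialOrder L] [OrderBot L] : Setoid (LPOF V L) where
  r := LPOF.Iso
  iseqv := ⟨LPOF.Iso.refl, LPOF.Iso.symm, LPOF.Iso.trans⟩

/-- Pomsets with formulae: isomorphism classes of LPOFs. -/
def Pom (V L : Type*) [PartialOrder L] [OrderBot L] : Type _ := Quotient (LPOF.setoid V L)

namespace Pom

variable {V L : Type*} [PartialOrder L] [OrderBot L]

/-- The isomorphism class of an LPOF. -/
def mk (α : LPOF V L) : Pom V L := Quotient.mk _ α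

/-- `α` is a representative of the pomset `A`. -/
instance : Membership (LPOF V L) (Pom V L) where
  mem A α := mk α = A

/-- The order on pomsets: every representative of the larger pomset lies above a representative of
the smaller one. -/
instance : LE (Pom V L) where
  le A B := ∀ β ∈ B, ∃ α ∈ A, LPOF.Below α β

/-- The finite pomsets, those with finitely many nodes. -/
def finitePomsets (V L : Type*) [PartialOrder L] [OrderBot L] : Set (Pom V L) :=
  {A | ∃ α ∈ A, α.nodes.Finite}

/-- The finite approximations of a pomset. -/
def finApprox (A : Pom V L) : Set (Pom V L) := {B | B ∈ finitePomsets V L ∧ B ≤ A}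

end Pom


/-! ### Renaming of nodes, and the order on pomsets in terms of representatives -/

namespace LPOF

variable {V L : Type*} [PartialOrder L] [OrderBot L]

/-- The image of the relation of `α` under `f`. -/
def mapLt (α : LPOF V L) (f : V → V) (u v : V) : Prop :=
  ∃ x y, α.lt x y ∧ f x = u ∧ f y = v

section MapLt

variable (α : LPOF V L) {f : V → V}

theorem mapLt_iff (hf : Set.InjOn f α.nodes) {x y : V} (hx : x ∈ α.nodes) (hy : y ∈ α.nodes) :
    α.mapLt f (f x) (f y) ↔ α.lt x y := by
  constructor
  · rintro ⟨a, b, hab, ha, hb⟩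
    have h := α.lt_mem a b hab
    rwa [← hf h.1 hx ha, ← hf h.2 hy hb]
  · intro h
    exact ⟨x, y, h, rfl, rfl⟩

theorem predPlus_mapLt (hf : Set.InjOn f α.nodes) {x : V} (hx : x ∈ α.nodes) :
    predPlus (α.mapLt f) (f x) = f '' predPlus α.lt x := by
  ext u
  constructor
  · rintro ⟨a, b, hab, rfl, hb⟩
    rw [hf (α.lt_mem a b hab).2 hx hb] at hab
    exact ⟨a, hab, rfl⟩
  · rintro ⟨a, ha, rfl⟩
    exact ⟨a, x, ha, rfl, rfl⟩

theorem between_mapLt (hf : Set.InjOn f α.nodes) {x y : V} (hx : x ∈ α.nodes) (hy : y ∈ α.nodes) :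
    (∃ z, α.mapLt f (f x) z ∧ α.mapLt f z (f y)) ↔ ∃ z, α.lt x z ∧ α.lt z y := by
  constructor
  · rintro ⟨z, ⟨a, b, hab, ha, rfl⟩, h2⟩
    have hb := (α.lt_mem a b hab).2
    exact ⟨b, (α.mapLt_iff hf hx hb).1 ⟨a, b, hab, ha, rfl⟩, (α.mapLt_iff hf hb hy).1 h2⟩
  · rintro ⟨z, h1, h2⟩
    exact ⟨f z, ⟨x, z, h1, rfl, rfl⟩, ⟨z, y, h2, rfl, rfl⟩⟩

theorem succ_mapLt (hf : Set.InjOn f α.nodes) {x : V} (hx : x ∈ α.nodes) :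
    succ (α.mapLt f) (f x) = f '' succ α.lt x := by
  ext u
  constructor
  · rintro ⟨⟨a, b, hab, ha, rfl⟩, h2⟩
    have hb := (α.lt_mem a b hab).2
    rw [hf (α.lt_mem a b hab).1 hx ha] at hab
    exact ⟨b, ⟨hab, fun h => h2 ((α.between_mapLt hf hx hb).2 h)⟩, rfl⟩
  · rintro ⟨b, ⟨h1, h2⟩, rfl⟩
    exact ⟨⟨x, b, h1, rfl, rfl⟩,
      fun h => h2 ((α.between_mapLt hf hx (α.lt_mem _ _ h1).2).1 h)⟩

theorem pred_mapLt (hf : Set.InjOn f α.nodes) {x : V} (hx : x ∈ α.nodes) :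
    pred (α.mapLt f) (f x) = f '' pred α.lt x := by
  ext u
  constructor
  · rintro ⟨⟨a, b, hab, rfl, hb⟩, h2⟩
    have ha := (α.lt_mem a b hab).1
    rw [hf (α.lt_mem a b hab).2 hx hb] at hab
    exact ⟨a, ⟨hab, fun h => h2 ((α.between_mapLt hf ha hx).2 h)⟩, rfl⟩
  · rintro ⟨b, ⟨h1, h2⟩, rfl⟩
    exact ⟨⟨b, x, h1, rfl, rfl⟩,
      fun h => h2 ((α.between_mapLt hf (α.lt_mem _ _ h1).1 hx).1 h)⟩

theorem minNodes_mapLt (hf : Set.InjOn f α.nodes) :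
    minNodes (f '' α.nodes) (α.mapLt f) = f '' minNodes α.nodes α.lt := by
  ext u
  constructor
  · rintro ⟨⟨x, hx, rfl⟩, h⟩
    rw [α.pred_mapLt hf hx, Set.image_eq_empty] at h
    exact ⟨x, ⟨hx, h⟩, rfl⟩
  · rintro ⟨x, ⟨hx, h⟩, rfl⟩
    exact ⟨⟨x, hx, rfl⟩, by rw [α.pred_mapLt hf hx, h, Set.image_empty]⟩

theorem level_mapLt (hf : Set.InjOn f α.nodes) {x : V} (hx : x ∈ α.nodes) :
    level (f '' α.nodes) (α.mapLt f) (f x) = level α.nodes α.lt x := by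
  unfold level
  congr 1
  ext n
  constructor
  · rintro ⟨s, h0, hn, hs⟩
    have : Nonempty V := ⟨x⟩
    have hmem : ∀ i ≤ n, ∃ a ∈ α.nodes, f a = s i := by
      intro i hi
      rcases i with _ | i
      · obtain ⟨a, ha, _⟩ := h0.1
        exact ⟨a, ha, by assumption⟩
      · obtain ⟨⟨a, b, hab, _, hb⟩, _⟩ := hs i hi
        exact ⟨b, (α.lt_mem a b hab).2, hb⟩
    choose! t ht hft using hmem
    have hx' : t n = x := hf (ht n le_rfl) hx (by rw [hft n le_rfl, hn])
    refine ⟨t, ?_, hx', ?_⟩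
    · rw [α.minNodes_mapLt hf] at h0
      obtain ⟨a, ha, hfa⟩ := h0
      rwa [hf (ht 0 (Nat.zero_le n)) ha.1 (by rw [hft 0 (Nat.zero_le n), hfa])]
    · intro i hi
      have h := hs i hi
      rw [← hft i hi.le, α.succ_mapLt hf (ht i hi.le)] at h
      obtain ⟨b, hb, hfb⟩ := h
      rwa [hf (ht (i + 1) hi) (α.lt_mem _ _ hb.1).2 (by rw [hft (i + 1) hi, hfb])]
  · rintro ⟨s, h0, hn, hs⟩
    have hmem : ∀ i ≤ n, s i ∈ α.nodes := by
      intro i hi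
      rcases i with _ | i
      · exact h0.1
      · exact (α.lt_mem _ _ (hs i hi).1).2
    refine ⟨fun i => f (s i), ?_, by simp [hn], ?_⟩
    · rw [α.minNodes_mapLt hf]
      exact ⟨_, h0, rfl⟩
    · intro i hi
      rw [α.succ_mapLt hf (hmem i hi.le)]
      exact ⟨_, hs i hi, rfl⟩

end MapLt

open Classical in
/-- Renaming the nodes of `α` along `f`. -/
noncomputable def map (α : LPOF V L) (f : V → V) (hf : Set.InjOn f α.nodes) : LPOF V L where
  nodes := f '' α.nodes
  lt := α.mapLt f
  label u := if h : ∃ x ∈ α.nodes, f x = u then α.label h.choose else ⊥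
  form u := if h : ∃ x ∈ α.nodes, f x = u then (α.form h.choose).map f else Form.tru
  countable_nodes := α.countable_nodes.image f
  lt_mem := by
    rintro _ _ ⟨a, b, hab, rfl, rfl⟩
    exact ⟨⟨a, (α.lt_mem a b hab).1, rfl⟩, ⟨b, (α.lt_mem a b hab).2, rfl⟩⟩
  lt_irrefl := by
    rintro _ ⟨a, b, hab, rfl, h⟩
    have hm := α.lt_mem a b hab
    rw [hf hm.2 hm.1 h] at hab
    exact α.lt_irrefl _ hab
  lt_trans := by
    rintro _ _ _ ⟨a, b, hab, rfl, rfl⟩ ⟨c, d, hcd, h, rfl⟩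
    rw [hf (α.lt_mem c d hcd).1 (α.lt_mem a b hab).2 h] at hcd
    exact ⟨a, d, α.lt_trans _ _ _ hab hcd, rfl, rfl⟩
  finite_predPlus := by
    rintro _ ⟨x, hx, rfl⟩
    rw [α.predPlus_mapLt hf hx]
    exact (α.finite_predPlus x hx).image f
  finite_level := by
    intro n
    refine ((α.finite_level n).image f).subset ?_
    rintro _ ⟨⟨x, hx, rfl⟩, h⟩
    rw [α.level_mapLt hf hx] at h
    exact ⟨x, ⟨hx, h⟩, rfl⟩
  single_root := by
    obtain ⟨r, hr⟩ := α.single_root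
    exact ⟨f r, by rw [α.minNodes_mapLt hf, hr, Set.image_singleton]⟩
  succ_bot := by
    rintro _ ⟨x, hx, rfl⟩ h
    have he : ∃ y ∈ α.nodes, f y = f x := ⟨x, hx, rfl⟩
    rw [dif_pos he, hf he.choose_spec.1 hx he.choose_spec.2] at h
    rw [α.succ_mapLt hf hx, α.succ_bot x hx h, Set.image_empty]
  form_sat := by
    rintro _ ⟨x, hx, rfl⟩
    have : Nonempty V := ⟨x⟩
    have he : ∃ y ∈ α.nodes, f y = f x := ⟨x, hx, rfl⟩
    rw [dif_pos he, hf he.choose_spec.1 hx he.choose_spec.2]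
    obtain ⟨v, hv⟩ := α.form_sat x hx
    refine ⟨fun u => v (Function.invFunOn f α.nodes u), ?_⟩
    rw [Form.sat_map]
    refine (Form.sat_congr _ fun y hy => ?_).1 hv
    exact congrArg v (hf.leftInvOn_invFunOn (α.free_subset hx hy)).symm
  form_free := by
    rintro _ ⟨x, hx, rfl⟩
    have he : ∃ y ∈ α.nodes, f y = f x := ⟨x, hx, rfl⟩
    rw [dif_pos he, hf he.choose_spec.1 hx he.choose_spec.2, Form.free_map,
      α.predPlus_mapLt hf hx]
    exact Set.image_mono (α.form_free x hx)
  form_entails := by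
    rintro _ _ ⟨a, b, hab, rfl, rfl⟩
    have hm := α.lt_mem a b hab
    have ha : ∃ y ∈ α.nodes, f y = f a := ⟨a, hm.1, rfl⟩
    have hb : ∃ y ∈ α.nodes, f y = f b := ⟨b, hm.2, rfl⟩
    rw [dif_pos ha, hf ha.choose_spec.1 hm.1 ha.choose_spec.2,
      dif_pos hb, hf hb.choose_spec.1 hm.2 hb.choose_spec.2]
    intro v hv
    rw [Form.sat_map] at hv ⊢
    exact α.form_entails a b hab _ hv
  label_outside := fun _ hu => dif_neg hu
  form_outside := fun _ hu => dif_neg hu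

variable {α β : LPOF V L} {f g : V → V}

theorem map_label (hf : Set.InjOn f α.nodes) {x : V} (hx : x ∈ α.nodes) :
    (α.map f hf).label (f x) = α.label x := by
  have he : ∃ y ∈ α.nodes, f y = f x := ⟨x, hx, rfl⟩
  simp only [map]
  rw [dif_pos he, hf he.choose_spec.1 hx he.choose_spec.2]

theorem map_form (hf : Set.InjOn f α.nodes) {x : V} (hx : x ∈ α.nodes) :
    (α.map f hf).form (f x) = (α.form x).map f := by
  have he : ∃ y ∈ α.nodes, f y = f x := ⟨x, hx, rfl⟩
  simp only [map]
  rw [dif_pos he, hf he.choose_spec.1 hx he.choose_spec.2]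

theorem isIso_map (hf : Set.InjOn f α.nodes) : IsIso f α (α.map f hf) where
  bijOn := hf.bijOn_image
  lt_iff _ hx _ hy := (α.mapLt_iff hf hx hy).symm
  label_eq _ hx := map_label hf hx
  form_eq _ hx := map_form hf hx

/-- Renaming along two functions that agree on the nodes gives the same LPOF. -/
theorem IsIso.eq_map (h : IsIso f α β) (hg : Set.InjOn g α.nodes)
    (hfg : ∀ x ∈ α.nodes, g x = f x) : β = α.map g hg := by
  have hn : β.nodes = g '' α.nodes := by
    rw [← h.bijOn.image_eq]
    exact (Set.image_congr hfg).symm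
  refine LPOF.ext hn ?_ ?_ ?_
  · funext u v
    apply propext
    constructor
    · intro huv
      have hm := β.lt_mem u v huv
      rw [← h.bijOn.image_eq] at hm
      obtain ⟨⟨x, hx, rfl⟩, ⟨y, hy, rfl⟩⟩ := hm
      exact ⟨x, y, (h.lt_iff x hx y hy).2 huv, hfg x hx, hfg y hy⟩
    · rintro ⟨x, y, hxy, rfl, rfl⟩
      have hm := α.lt_mem x y hxy
      rw [hfg x hm.1, hfg y hm.2]
      exact (h.lt_iff x hm.1 y hm.2).1 hxy
  · funext u
    by_cases hu : u ∈ β.nodes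
    · obtain ⟨x, hx, rfl⟩ := hn ▸ hu
      rw [map_label hg hx, hfg x hx, h.label_eq x hx]
    · rw [β.label_outside u hu]
      exact ((α.map g hg).label_outside u (by rwa [hn] at hu)).symm
  · funext u
    by_cases hu : u ∈ β.nodes
    · obtain ⟨x, hx, rfl⟩ := hn ▸ hu
      rw [map_form hg hx, hfg x hx, h.form_eq x hx]
      exact Form.map_congr _ fun y hy => (hfg y (α.free_subset hx hy)).symm
    · rw [β.form_outside u hu]
      exact ((α.map g hg).form_outside u (by rwa [hn] at hu)).symm

theorem Below.map (h : Below α β) (hf : Set.InjOn f β.nodes) :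
    Below (α.map f (hf.mono h.1.1)) (β.map f hf) := by
  obtain ⟨⟨hsub, hdown⟩, hlt, hx⟩ := h
  have hbot : (α.map f (hf.mono hsub)).botNodes = f '' α.botNodes := by
    ext u
    constructor
    · rintro ⟨⟨x, hxα, rfl⟩, hl⟩
      rw [map_label _ hxα] at hl
      exact ⟨x, ⟨hxα, hl⟩, rfl⟩
    · rintro ⟨x, ⟨hxα, hl⟩, rfl⟩
      exact ⟨⟨x, hxα, rfl⟩, by rw [map_label _ hxα, hl]⟩
  refine ⟨⟨Set.image_mono hsub, ?_⟩, ?_, ?_⟩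
  · rintro _ ⟨x, hxα, rfl⟩
    change predPlus (β.mapLt f) (f x) ⊆ f '' α.nodes
    rw [β.predPlus_mapLt hf (hsub hxα)]
    exact Set.image_mono (hdown x hxα)
  · intro u v
    constructor
    · rintro ⟨x, y, hxy, rfl, rfl⟩
      have hm := α.lt_mem x y hxy
      exact ⟨⟨x, y, ((hlt x y).1 hxy).1, rfl, rfl⟩, ⟨x, hm.1, rfl⟩, ⟨y, hm.2, rfl⟩⟩
    · rintro ⟨huv, ⟨x, hxα, rfl⟩, ⟨y, hyα, rfl⟩⟩
      exact ⟨x, y, (hlt x y).2 ⟨(β.mapLt_iff hf (hsub hxα) (hsub hyα)).1 huv, hxα, hyα⟩, rfl, rfl⟩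
  · rintro _ ⟨x, hxα, rfl⟩
    rw [map_label _ hxα, map_form _ hxα, map_label _ (hsub hxα), map_form _ (hsub hxα)]
    obtain ⟨h1, h2, h3⟩ := hx x hxα
    refine ⟨h1, by rw [h2], ?_⟩
    change succ (α.mapLt f) (f x) = succ (β.mapLt f) (f x) \ _
    rw [α.succ_mapLt (hf.mono hsub) hxα, β.succ_mapLt hf (hsub hxα), h3, hbot]
    ext u
    constructor
    · rintro ⟨y, ⟨hy, hyb⟩, rfl⟩
      have hyβ := (β.lt_mem _ _ hy.1).2
      refine ⟨⟨y, hy, rfl⟩, fun hc => hyb ?_⟩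
      obtain ⟨_, ⟨_, rfl⟩, _, ⟨⟨z, hz, rfl⟩, rfl⟩, hc⟩ := hc
      exact Set.mem_biUnion hz ((β.mapLt_iff hf (hsub hz.1) hyβ).1 hc)
    · rintro ⟨⟨y, hy, rfl⟩, hyb⟩
      refine ⟨y, ⟨hy, fun hc => hyb ?_⟩, rfl⟩
      obtain ⟨_, ⟨z, rfl⟩, _, ⟨hz, rfl⟩, hc⟩ := hc
      exact Set.mem_biUnion (Set.mem_image_of_mem f hz) ⟨z, y, hc, rfl, rfl⟩

end LPOF

namespace Pom

variable {V L : Type*} [PartialOrder L] [OrderBot L]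

/-- One pair of representatives suffices. -/
theorem le_iff_exists (A B : Pom V L) : A ≤ B ↔ ∃ α ∈ A, ∃ β ∈ B, LPOF.Below α β := by
  constructor
  · intro h
    obtain ⟨β, hβ⟩ := Quotient.exists_rep B
    obtain ⟨α, hα, hb⟩ := h β hβ
    exact ⟨α, hα, β, hβ, hb⟩
  · rintro ⟨α, hα, β, hβ, hb⟩ β' hβ'
    obtain ⟨f, hf⟩ : LPOF.Iso β β' := Quotient.exact (hβ.trans hβ'.symm)
    refine ⟨α.map f (hf.bijOn.injOn.mono hb.1.1), ?_, ?_⟩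
    · exact (Quotient.sound (LPOF.Iso.symm ⟨f, LPOF.isIso_map _⟩)).trans hα
    · have h := hb.map hf.bijOn.injOn
      rwa [← hf.eq_map hf.bijOn.injOn fun _ _ => rfl] at h

open Classical in
/-- When fresh nodes are available outside each representative of the smaller pomset (as for a
finite pomset over an infinite `V`), the order on pomsets is also the one that asks each
representative of the smaller pomset to lie below a representative of the larger one. -/
theorem le_iff_forall_exists (A B : Pom V L) (hA : ∀ α ∈ A, (α.nodesᶜ).Infinite) :
    A ≤ B ↔ ∀ α ∈ A, ∃ β ∈ B, LPOF.Below α β := by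
  rw [le_iff_exists]
  constructor
  · rintro ⟨α, hα, β, hβ, hb⟩ α' hα'
    obtain ⟨f, hf⟩ : LPOF.Iso α α' := Quotient.exact (hα.trans hα'.symm)
    have hinf := hA α' hα'
    obtain ⟨e, he⟩ := Set.countable_iff_exists_injOn.1 β.countable_nodes
    have := hinf.to_subtype
    let j := Infinite.natEmbedding (α'.nodesᶜ : Set V)
    let g : V → V := fun x => if x ∈ α.nodes then f x else (j (e x) : V)
    have hgα : ∀ x ∈ α.nodes, g x = f x := fun x hx => if_pos hx
    have hgβ : ∀ x, x ∉ α.nodes → g x = (j (e x) : V) := fun x hx => if_neg hx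
    have hg : Set.InjOn g β.nodes := by
      intro x hx y hy hxy
      by_cases hxα : x ∈ α.nodes <;> by_cases hyα : y ∈ α.nodes
      · rw [hgα x hxα, hgα y hyα] at hxy
        exact hf.bijOn.injOn hxα hyα hxy
      · rw [hgα x hxα, hgβ y hyα] at hxy
        exact absurd (hxy ▸ hf.bijOn.mapsTo hxα) (j (e y)).2
      · rw [hgβ x hxα, hgα y hyα] at hxy
        exact absurd (hxy ▸ hf.bijOn.mapsTo hyα) (j (e x)).2
      · rw [hgβ x hxα, hgβ y hyα] at hxy
        exact he hx hy (j.injective (Subtype.ext hxy))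
    refine ⟨β.map g hg, ?_, ?_⟩
    · exact (Quotient.sound (LPOF.Iso.symm ⟨g, LPOF.isIso_map _⟩)).trans hβ
    · rw [hf.eq_map (hg.mono hb.1.1) hgα]
      exact hb.map hg
  · intro h
    obtain ⟨α, hα⟩ := Quotient.exists_rep A
    obtain ⟨β, hβ, hb⟩ := h α hα
    exact ⟨α, hα, β, hβ, hb⟩

/-- Over an uncountable universe of nodes the two orders always agree. -/
theorem le_iff_forall_exists_of_uncountable [Uncountable V] (A B : Pom V L) :
    A ≤ B ↔ ∀ α ∈ A, ∃ β ∈ B, LPOF.Below α β :=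
  le_iff_forall_exists A B fun α _ hfin =>
    Set.not_countable_univ (by simpa using α.countable_nodes.union hfin.countable)

end Pom

end Pomset

/-!
The order on pomsets is embeddability: `A ≤ B` iff a representative of `A` embeds into one of `B` as
a downward closed part, possibly with smaller labels, such that every new node lies above a node
labelled `⊥` (`Pom.mk_le_mk`). Embeddings preserve levels. As levels are finite, mutual embeddings
are isomorphisms (`LPOF.Emb.isIso`), so this is a partial order.

Everything rests on the truncations `trunc n A`, obtained by keeping the nodes up to level `n` and
relabelling level `n` by `⊥`. They are finite approximations of `A`, monotone in `A`, and a pomset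
is finite iff it equals one of its truncations. Three facts make `Pom` behave like an inverse limit
of finite objects.

* If all truncations of `A` are below `B`, then so is `A` (`Pom.le_of_forall_trunc_le`): embeddings
  of the truncations have only finitely many choices for each node, so they have a limit.
* A sequence of pomsets in which each is the corresponding truncation of the next consists of the
  truncations of a single pomset (`Pom.exists_trunc_eq`): choose representatives each of which
  extends the previous one, with fresh nodes from the infinite `V`, and take their union.
* On a directed set, each truncation is eventually constant (`Pom.exists_forall_trunc_eq`). The
  labels satisfy the ascending chain condition, since an element of `L` has only finitely many
  elements below it. Once the nodes below a level and their labels are fixed, no new nodes can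
  appear on that level, because new nodes grow only above nodes whose label `⊥` has been replaced.

Hence a directed set `S` has a supremum `M`, namely the pomset whose truncations are the eventual
truncations on `S`, and each `trunc n M` is below an element of `S` (`Pom.exists_isLUB`). So finite
pomsets are compact, and the approximation order and algebraicity are read off from the directed
set of finite approximations.
-/

namespace Pomset

/-! ### Levels in finitely preceded orders -/

section Level

variable {V : Type*} {N : Set V} {lt : V → V → Prop}

/-- `lt` is a strict partial order on `N` in which every element has only finitely many elements
below it. -/
structure IsFinPrecOrder (N : Set V) (lt : V → V → Prop) : Prop where
  mem : ∀ x y, lt x y → x ∈ N ∧ y ∈ N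
  irrefl : ∀ x, ¬ lt x x
  trans : ∀ x y z, lt x y → lt y z → lt x z
  finite : ∀ x ∈ N, (predPlus lt x).Finite

/-- There is a path of `n` immediate successors from a minimal node to `x`. -/
def HasPath (N : Set V) (lt : V → V → Prop) (n : ℕ) (x : V) : Prop :=
  ∃ s : ℕ → V, s 0 ∈ minNodes N lt ∧ s n = x ∧ ∀ i < n, s (i + 1) ∈ succ lt (s i)

theorem hasPath_zero {x : V} : HasPath N lt 0 x ↔ x ∈ minNodes N lt :=
  ⟨fun ⟨_, h, e, _⟩ => e ▸ h, fun h => ⟨fun _ => x, h, rfl, fun _ hi => absurd hi (by omega)⟩⟩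

theorem hasPath_succ {n : ℕ} {y : V} :
    HasPath N lt (n + 1) y ↔ ∃ x, HasPath N lt n x ∧ y ∈ succ lt x := by
  constructor
  · rintro ⟨s, h0, rfl, hs⟩
    exact ⟨s n, ⟨s, h0, rfl, fun i hi => hs i (by omega)⟩, hs n (by omega)⟩
  · rintro ⟨_, ⟨s, h0, rfl, hs⟩, hy⟩
    refine ⟨fun i => if i ≤ n then s i else y, by simpa using h0, by simp, fun i hi => ?_⟩
    rcases Nat.lt_succ_iff_lt_or_eq.1 hi with h | rfl
    · simpa [h.le, Nat.succ_le_of_lt h] using hs i h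
    · simpa using hy

namespace IsFinPrecOrder

variable (h : IsFinPrecOrder N lt)
include h

theorem ncard_lt {x y : V} (hxy : lt x y) :
    (predPlus lt x).ncard < (predPlus lt y).ncard := by
  refine Set.ncard_lt_ncard ⟨fun z hz => h.trans _ _ _ hz hxy, fun hs => ?_⟩
    (h.finite y (h.mem _ _ hxy).2)
  exact h.irrefl x (hs hxy)

theorem wellFounded : WellFounded lt :=
  Subrelation.wf (fun hxy => h.ncard_lt hxy) (measure fun x => (predPlus lt x).ncard).wf

theorem succ_nonempty {x y : V} (hxy : lt x y) : (succ lt x).Nonempty := by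
  obtain ⟨z, hz, hmin⟩ := h.wellFounded.has_min {z | lt x z} ⟨y, hxy⟩
  exact ⟨z, hz, fun ⟨w, hw, hwz⟩ => hmin w hw hwz⟩

theorem exists_pred {x y : V} (hxy : lt x y) :
    ∃ w, (x = w ∨ lt x w) ∧ y ∈ succ lt w := by
  obtain ⟨w, ⟨hxw, hwy⟩, hmax⟩ := Set.exists_max_image {w | (x = w ∨ lt x w) ∧ lt w y}
    (fun w => (predPlus lt w).ncard)
    ((h.finite y (h.mem _ _ hxy).2).subset fun w hw => hw.2) ⟨x, Or.inl rfl, hxy⟩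
  refine ⟨w, hxw, hwy, fun ⟨z, hwz, hzy⟩ => ?_⟩
  have hxz : lt x z := hxw.elim (fun e => e ▸ hwz) fun e => h.trans _ _ _ e hwz
  exact absurd (h.ncard_lt hwz) (not_lt.2 (hmax z ⟨Or.inr hxz, hzy⟩))

theorem mem_minNodes {x : V} : x ∈ minNodes N lt ↔ x ∈ N ∧ ∀ y, ¬ lt y x := by
  refine and_congr_right fun _ => ⟨fun hp y hy => ?_, fun hp => ?_⟩
  · obtain ⟨w, -, hw⟩ := h.exists_pred hy
    have : w ∈ pred lt x := hw
    rwa [hp] at this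
  · exact Set.eq_empty_of_forall_notMem fun y hy => hp y hy.1

theorem exists_minNode {x : V} (hx : x ∈ N) : ∃ r ∈ minNodes N lt, r = x ∨ lt r x := by
  obtain ⟨r, ⟨hrN, hr⟩, hmin⟩ := h.wellFounded.has_min {r | r ∈ N ∧ (r = x ∨ lt r x)}
    ⟨x, hx, Or.inl rfl⟩
  refine ⟨r, h.mem_minNodes.2 ⟨hrN, fun y hy => hmin y ⟨(h.mem _ _ hy).1, Or.inr ?_⟩ hy⟩, hr⟩
  exact hr.elim (fun e => e ▸ hy) fun e => h.trans _ _ _ hy e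

theorem exists_hasPath {x : V} (hx : x ∈ N) : ∃ n, HasPath N lt n x := by
  induction x using h.wellFounded.induction with
  | _ x ih =>
    by_cases hm : ∃ y, lt y x
    · obtain ⟨y, hy⟩ := hm
      obtain ⟨w, -, hw⟩ := h.exists_pred hy
      obtain ⟨n, hn⟩ := ih w hw.1 (h.mem _ _ hw.1).1
      exact ⟨n + 1, hasPath_succ.2 ⟨w, hn, hw⟩⟩
    · exact ⟨0, hasPath_zero.2 (h.mem_minNodes.2 ⟨hx, not_exists.1 hm⟩)⟩

theorem hasPath_le {n : ℕ} {x : V} (hn : HasPath N lt n x) : n ≤ (predPlus lt x).ncard := by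
  induction n generalizing x with
  | zero => exact Nat.zero_le _
  | succ n ih =>
    obtain ⟨w, hw, hx⟩ := hasPath_succ.1 hn
    exact (ih hw).trans_lt (h.ncard_lt hx.1)

theorem isGreatest_level {x : V} (hx : x ∈ N) :
    IsGreatest {n | HasPath N lt n x} (level N lt x) := by
  have hb : BddAbove {n | HasPath N lt n x} := ⟨_, fun n hn => h.hasPath_le hn⟩
  exact ⟨Nat.sSup_mem (h.exists_hasPath hx) hb, fun n hn => le_csSup hb hn⟩

theorem hasPath_extend {n : ℕ} {x y : V} (hn : HasPath N lt n x) (hxy : lt x y) :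
    ∃ m, n < m ∧ HasPath N lt m y := by
  induction y using h.wellFounded.induction with
  | _ y ih =>
    obtain ⟨w, rfl | hxw, hw⟩ := h.exists_pred hxy
    · exact ⟨n + 1, Nat.lt_succ_self n, hasPath_succ.2 ⟨x, hn, hw⟩⟩
    · obtain ⟨m, hm, hp⟩ := ih w hw.1 hxw
      exact ⟨m + 1, hm.trans (Nat.lt_succ_self m), hasPath_succ.2 ⟨w, hp, hw⟩⟩

theorem level_lt {x y : V} (hxy : lt x y) : level N lt x < level N lt y := by
  obtain ⟨m, hm, hp⟩ := h.hasPath_extend (h.isGreatest_level (h.mem _ _ hxy).1).1 hxy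
  exact hm.trans_le ((h.isGreatest_level (h.mem _ _ hxy).2).2 hp)

/-- A longest path to `y` passes through every smaller level. -/
theorem exists_lt_level_eq {n : ℕ} {y : V} (hy : y ∈ N) (hn : n < level N lt y) :
    ∃ z, lt z y ∧ level N lt z = n := by
  induction y using h.wellFounded.induction with
  | _ y ih =>
    obtain ⟨k, hk⟩ : ∃ k, level N lt y = k + 1 := ⟨level N lt y - 1, by omega⟩
    have hp : HasPath N lt (k + 1) y := hk ▸ (h.isGreatest_level hy).1
    obtain ⟨x, hx, hxy⟩ := hasPath_succ.1 hp
    have hxN := (h.mem _ _ hxy.1).1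
    have h1 : k ≤ level N lt x := (h.isGreatest_level hxN).2 hx
    have h2 := h.level_lt hxy.1
    rcases (show n = level N lt x ∨ n < level N lt x by omega) with e | e
    · exact ⟨x, hxy.1, e.symm⟩
    · obtain ⟨z, hz, hzn⟩ := ih x hxy.1 hxN e
      exact ⟨z, h.trans _ _ _ hz hxy.1, hzn⟩

theorem level_le_iff {n : ℕ} {y : V} (hy : y ∈ N) :
    level N lt y ≤ n ↔ ∀ z, lt z y → level N lt z < n := by
  refine ⟨fun hn z hz => (h.level_lt hz).trans_le hn, fun hn => ?_⟩
  by_contra hc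
  obtain ⟨z, hz, hzn⟩ := h.exists_lt_level_eq hy (not_le.1 hc)
  exact (hn z hz).ne hzn

theorem level_eq_zero {r : V} (hr : r ∈ minNodes N lt) : level N lt r = 0 :=
  have hr' := h.mem_minNodes.1 hr
  Nat.le_zero.1 ((h.level_le_iff hr'.1).2 fun z hz => absurd hz (hr'.2 z))

/-- Maps onto downward closed sets that preserve the order preserve levels. -/
theorem level_map {W : Type*} {M : Set W} {lt' : W → W → Prop} (h' : IsFinPrecOrder M lt')
    {f : V → W} (hf : Set.MapsTo f N M) (hlt : ∀ x y, lt x y → lt' (f x) (f y))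
    (hdown : ∀ x ∈ N, ∀ w, lt' w (f x) → ∃ z, lt z x ∧ f z = w) {x : V} (hx : x ∈ N) :
    level M lt' (f x) = level N lt x := by
  induction x using h.wellFounded.induction with
  | _ x ih =>
    refine eq_of_forall_ge_iff fun n => ?_
    rw [h.level_le_iff hx, h'.level_le_iff (hf hx)]
    constructor
    · intro hn z hz
      exact ih z hz (h.mem _ _ hz).1 ▸ hn _ (hlt _ _ hz)
    · intro hn w hw
      obtain ⟨z, hz, rfl⟩ := hdown x hx w hw
      exact (ih z hz (h.mem _ _ hz).1).symm ▸ hn z hz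

end IsFinPrecOrder

end Level

/-! ### Embeddings -/

theorem Form.map_id {V : Type*} (p : Form V) : Form.map (fun x => x) p = p :=
  Form.map_eq_self p fun _ _ => rfl

namespace LPOF

variable {V L : Type*} [PartialOrder L] [OrderBot L] {α β γ : LPOF V L} {f g : V → V}

theorem isFinPrecOrder (α : LPOF V L) : IsFinPrecOrder α.nodes α.lt :=
  ⟨α.lt_mem, α.lt_irrefl, α.lt_trans, α.finite_predPlus⟩

theorem exists_root (α : LPOF V L) : ∃ r ∈ α.nodes, ∀ x ∈ α.nodes, r = x ∨ α.lt r x := by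
  obtain ⟨r, hr⟩ := α.single_root
  refine ⟨r, (hr ▸ Set.mem_singleton r : r ∈ minNodes α.nodes α.lt).1, fun x hx => ?_⟩
  obtain ⟨r', hr', h⟩ := α.isFinPrecOrder.exists_minNode hx
  rw [hr] at hr'
  exact Set.mem_singleton_iff.1 hr' ▸ h

/-- Nodes labelled `⊥` are maximal. -/
theorem label_ne_bot_of_lt {x y : V} (hxy : α.lt x y) : α.label x ≠ ⊥ := fun hb => by
  have := α.isFinPrecOrder.succ_nonempty hxy
  rw [α.succ_bot x (α.lt_mem _ _ hxy).1 hb] at this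
  exact Set.not_nonempty_empty this

/-- The level of a node of `α`. -/
noncomputable def lev (α : LPOF V L) (x : V) : ℕ := level α.nodes α.lt x

theorem lev_lt_lev {x y : V} (h : α.lt x y) : α.lev x < α.lev y := α.isFinPrecOrder.level_lt h

theorem finite_lev_le (α : LPOF V L) (n : ℕ) : {x ∈ α.nodes | α.lev x ≤ n}.Finite := by
  refine ((Set.finite_Iic n).biUnion fun k _ => α.finite_level k).subset fun x hx => ?_
  exact Set.mem_biUnion (Set.mem_Iic.2 hx.2) ⟨hx.1, rfl⟩

/-- `f` embeds `α` into `β`: it carries `α` to an LPOF below `β`. The condition on successors is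
replaced by the equivalent requirement that all nodes of `β` outside the image lie above the image
of a node labelled `⊥`. -/
structure Emb (f : V → V) (α β : LPOF V L) : Prop where
  mapsTo : Set.MapsTo f α.nodes β.nodes
  injOn : Set.InjOn f α.nodes
  lt_iff : ∀ x ∈ α.nodes, ∀ y ∈ α.nodes, α.lt x y ↔ β.lt (f x) (f y)
  down : ∀ x ∈ α.nodes, ∀ y, β.lt y (f x) → y ∈ f '' α.nodes
  label_le : ∀ x ∈ α.nodes, α.label x ≤ β.label (f x)
  form_eq : ∀ x ∈ α.nodes, β.form (f x) = (α.form x).map f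
  bot_lt : ∀ y ∈ β.nodes, y ∉ f '' α.nodes → ∃ z ∈ α.nodes, α.label z = ⊥ ∧ β.lt (f z) y

theorem IsIso.emb (h : IsIso f α β) : Emb f α β where
  mapsTo := h.bijOn.mapsTo
  injOn := h.bijOn.injOn
  lt_iff := h.lt_iff
  down _ _ _ hy := h.bijOn.surjOn (β.lt_mem _ _ hy).1
  label_le x hx := (h.label_eq x hx).ge
  form_eq := h.form_eq
  bot_lt _ hy hn := absurd (h.bijOn.surjOn hy) hn

theorem Emb.comp (hg : Emb g β γ) (hf : Emb f α β) : Emb (fun x => g (f x)) α γ where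
  mapsTo := hg.mapsTo.comp hf.mapsTo
  injOn := hg.injOn.comp hf.injOn hf.mapsTo
  lt_iff x hx y hy :=
    (hf.lt_iff x hx y hy).trans (hg.lt_iff _ (hf.mapsTo hx) _ (hf.mapsTo hy))
  down x hx y hy := by
    obtain ⟨w, hw, rfl⟩ := hg.down _ (hf.mapsTo hx) y hy
    obtain ⟨z, hz, rfl⟩ := hf.down x hx w ((hg.lt_iff _ hw _ (hf.mapsTo hx)).2 hy)
    exact ⟨z, hz, rfl⟩
  label_le x hx := (hf.label_le x hx).trans (hg.label_le _ (hf.mapsTo hx))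
  form_eq x hx := by rw [hg.form_eq _ (hf.mapsTo hx), hf.form_eq x hx, Form.map_map]
  bot_lt y hy hn := by
    by_cases hyg : y ∈ g '' β.nodes
    · obtain ⟨w, hw, rfl⟩ := hyg
      obtain ⟨z, hz, hzb, hzw⟩ := hf.bot_lt w hw fun ⟨x, hx, e⟩ => hn ⟨x, hx, congrArg g e⟩
      exact ⟨z, hz, hzb, (hg.lt_iff _ (hf.mapsTo hz) _ hw).1 hzw⟩
    · obtain ⟨w, hw, hwb, hwy⟩ := hg.bot_lt y hy hyg
      by_cases hwf : w ∈ f '' α.nodes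
      · obtain ⟨z, hz, rfl⟩ := hwf
        exact ⟨z, hz, le_bot_iff.1 (hwb ▸ hf.label_le z hz), hwy⟩
      · obtain ⟨z, hz, hzb, hzw⟩ := hf.bot_lt w hw hwf
        exact ⟨z, hz, hzb, γ.lt_trans _ _ _ ((hg.lt_iff _ (hf.mapsTo hz) _ hw).1 hzw) hwy⟩

theorem Emb.down_lt (h : Emb f α β) {x : V} (hx : x ∈ α.nodes) {y : V} (hy : β.lt y (f x)) :
    ∃ z, α.lt z x ∧ f z = y := by
  obtain ⟨z, hz, rfl⟩ := h.down x hx y hy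
  exact ⟨z, (h.lt_iff z hz x hx).2 hy, rfl⟩

theorem Emb.lev_eq (h : Emb f α β) {x : V} (hx : x ∈ α.nodes) : β.lev (f x) = α.lev x :=
  α.isFinPrecOrder.level_map β.isFinPrecOrder h.mapsTo
    (fun x y hxy => (h.lt_iff x (α.lt_mem _ _ hxy).1 y (α.lt_mem _ _ hxy).2).1 hxy)
    (fun _ hx _ hw => h.down_lt hx hw) hx

theorem Emb.congr (h : Emb f α β) (hfg : ∀ x ∈ α.nodes, g x = f x) : Emb g α β := by
  have hi : g '' α.nodes = f '' α.nodes := Set.image_congr hfg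
  refine ⟨fun x hx => hfg x hx ▸ h.mapsTo hx, h.injOn.congr fun x hx => (hfg x hx).symm,
    fun x hx y hy => ?_, fun x hx y hy => ?_, fun x hx => ?_, fun x hx => ?_, fun y hy hn => ?_⟩
  · rw [hfg x hx, hfg y hy, h.lt_iff x hx y hy]
  · rw [hi]
    exact h.down x hx y (hfg x hx ▸ hy)
  · rw [hfg x hx]
    exact h.label_le x hx
  · rw [hfg x hx, h.form_eq x hx]
    exact Form.map_congr _ fun y hy => (hfg y (α.free_subset hx hy)).symm
  · obtain ⟨z, hz, hzb, hzy⟩ := h.bot_lt y hy (hi ▸ hn)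
    exact ⟨z, hz, hzb, (hfg z hz).symm ▸ hzy⟩

/-- The order on LPOFs is embeddability by the inclusion of nodes. A minimal node `y` of `β`
outside `α` is an immediate successor in `β`, but not in `α`, of a node of `α`; so it lies above a
node of `α` labelled `⊥`. -/
theorem Below.emb (h : Below α β) : Emb (fun x => x) α β := by
  obtain ⟨⟨hsub, hdown⟩, hlt, hx⟩ := h
  refine ⟨hsub, fun x _ y _ e => e, fun x hx y hy => ?_, fun x hx y hy => ?_,
    fun x h => (hx x h).1, fun x h => ?_, fun y hy hn => ?_⟩
  · rw [hlt]
    exact and_iff_left ⟨hx, hy⟩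
  · simpa using hdown x hx hy
  · rw [Form.map_id, (hx x h).2.1]
  · rw [Set.image_id'] at hn
    induction y using β.isFinPrecOrder.wellFounded.induction with
    | _ y ih =>
      by_cases hp : ∃ w, β.lt w y ∧ w ∉ α.nodes
      · obtain ⟨w, hwy, hw⟩ := hp
        obtain ⟨z, hz, hzb, hzw⟩ := ih w hwy (β.lt_mem _ _ hwy).1 hw
        exact ⟨z, hz, hzb, β.lt_trans _ _ _ hzw hwy⟩
      · push Not at hp
        obtain ⟨r, hr, -⟩ := α.exists_root
        obtain ⟨r', hr', hroot⟩ := β.exists_root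
        have hr'α : r' ∈ α.nodes := (hroot r (hsub hr)).elim (fun e => e ▸ hr) fun e => hdown r hr e
        have hr'y : β.lt r' y := (hroot y hy).resolve_left fun e => hn (e ▸ hr'α)
        obtain ⟨w, -, hwy⟩ := β.isFinPrecOrder.exists_pred hr'y
        have hw := hp w hwy.1
        have hns : y ∉ succ α.lt w := fun hs => hn (α.lt_mem _ _ hs.1).2
        rw [(hx w hw).2.2] at hns
        have hb : y ∈ succPlusSet β.lt α.botNodes := by
          by_contra hc
          exact hns ⟨hwy, hc⟩
        obtain ⟨z, hz, hzy⟩ := Set.mem_iUnion₂.1 hb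
        exact ⟨z, hz.1, hz.2, hzy⟩

theorem Emb.below (h : Emb (fun x => x) α β) : Below α β := by
  have hdown : ∀ x ∈ α.nodes, ∀ y, β.lt y x → y ∈ α.nodes := fun x hx y hy => by
    simpa using h.down x hx y hy
  refine ⟨⟨h.mapsTo, hdown⟩, fun x y => ⟨fun hxy => ?_, fun hxy => ?_⟩, fun x hx =>
    ⟨h.label_le x hx, ?_, ?_⟩⟩
  · have hm := α.lt_mem _ _ hxy
    exact ⟨(h.lt_iff x hm.1 y hm.2).1 hxy, hm⟩
  · exact (h.lt_iff x hxy.2.1 y hxy.2.2).2 hxy.1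
  · have := h.form_eq x hx
    rw [Form.map_id] at this
    exact this.symm
  · ext y
    constructor
    · rintro ⟨hxy, hs⟩
      have hy := (α.lt_mem _ _ hxy).2
      refine ⟨⟨(h.lt_iff x hx y hy).1 hxy, fun ⟨z, hxz, hzy⟩ => hs ?_⟩, fun hb => ?_⟩
      · have hz := hdown y hy z hzy
        exact ⟨z, (h.lt_iff x hx z hz).2 hxz, (h.lt_iff z hz y hy).2 hzy⟩
      · obtain ⟨z, hz, hzy⟩ := Set.mem_iUnion₂.1 hb
        exact label_ne_bot_of_lt ((h.lt_iff z hz.1 y hy).2 hzy) hz.2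
    · rintro ⟨⟨hxy, hs⟩, hb⟩
      have hy : y ∈ α.nodes := by
        by_contra hn
        obtain ⟨z, hz, hzb, hzy⟩ := h.bot_lt y (β.lt_mem _ _ hxy).2 (by simpa using hn)
        exact hb (Set.mem_iUnion₂.2 ⟨z, ⟨hz, hzb⟩, hzy⟩)
      refine ⟨(h.lt_iff x hx y hy).2 hxy, fun ⟨z, hxz, hzy⟩ => hs ?_⟩
      have hz := (α.lt_mem _ _ hxz).2
      exact ⟨z, (h.lt_iff x hx z hz).1 hxz, (h.lt_iff z hz y hy).1 hzy⟩

/-- LPOFs that embed into each other are isomorphic: both embeddings are bijections between the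
finite levels, and as their composite permutes each level, no label can grow along it. -/
theorem Emb.isIso (hf : Emb f α β) (hg : Emb g β α) : IsIso f α β := by
  have hA : ∀ n, Set.MapsTo f {x ∈ α.nodes | α.lev x ≤ n} {x ∈ β.nodes | β.lev x ≤ n} :=
    fun n x hx => ⟨hf.mapsTo hx.1, (hf.lev_eq hx.1).trans_le hx.2⟩
  have hB : ∀ n, Set.MapsTo g {x ∈ β.nodes | β.lev x ≤ n} {x ∈ α.nodes | α.lev x ≤ n} :=
    fun n x hx => ⟨hg.mapsTo hx.1, (hg.lev_eq hx.1).trans_le hx.2⟩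
  have hfi : ∀ n, Set.InjOn f {x ∈ α.nodes | α.lev x ≤ n} := fun n => hf.injOn.mono fun x hx => hx.1
  have hgi : ∀ n, Set.InjOn g {x ∈ β.nodes | β.lev x ≤ n} := fun n => hg.injOn.mono fun x hx => hx.1
  refine ⟨⟨hf.mapsTo, hf.injOn, fun y hy => ?_⟩, hf.lt_iff, fun x hx => ?_, hf.form_eq⟩
  · have hle := Set.ncard_le_ncard_of_injOn g (hB (β.lev y)) (hgi _) (α.finite_lev_le _)
    obtain ⟨x, hx, e⟩ := Set.surj_on_of_inj_on_of_ncard_le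
      (s := {x ∈ α.nodes | α.lev x ≤ β.lev y}) (fun x _ => f x) (fun x hx => hA _ hx)
      (fun x x' hx hx' e => hfi _ hx hx' e) hle (β.finite_lev_le _) y ⟨hy, le_rfl⟩
    exact ⟨x, hx.1, e.symm⟩
  · have hh := hg.comp hf
    have hm : Set.MapsTo (fun x => g (f x)) α.nodes α.nodes := hh.mapsTo
    have hmono : ∀ k, α.label (g (f x)) ≤ α.label ((fun x => g (f x))^[k + 1] x) := by
      intro k
      induction k with
      | zero => exact le_rfl
      | succ k ih =>
        rw [Function.iterate_succ_apply']
        exact ih.trans (hh.label_le _ (hm.iterate (k + 1) hx))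
    -- `x` is a periodic point of the composite, since its orbit stays within finitely many nodes
    have hper : ∃ k, (fun x => g (f x))^[k + 1] x = x := by
      have hmem : ∀ k, (fun x => g (f x))^[k] x ∈ {y ∈ α.nodes | α.lev y ≤ α.lev x} := by
        intro k
        induction k with
        | zero => exact ⟨hx, le_rfl⟩
        | succ k ih =>
          rw [Function.iterate_succ_apply']
          exact ⟨hm ih.1, (hh.lev_eq ih.1).trans_le ih.2⟩
      obtain ⟨a, -, b, -, hab, e⟩ := Set.infinite_univ.exists_lt_map_eq_of_mapsTo
        (fun k _ => hmem k) (α.finite_lev_le (α.lev x))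
      obtain ⟨k, rfl⟩ : ∃ k, b = a + (k + 1) := ⟨b - a - 1, by omega⟩
      refine ⟨k, ?_⟩
      rw [Function.iterate_add_apply] at e
      exact (hh.injOn.iterate hm a (hm.iterate (k + 1) hx) hx e.symm)
    obtain ⟨k, hk⟩ := hper
    have h3 : α.label (g (f x)) ≤ α.label x := (hmono k).trans_eq (congrArg α.label hk)
    exact le_antisymm ((hg.label_le _ (hf.mapsTo hx)).trans h3) (hf.label_le x hx)

theorem IsIso.eq (h : IsIso (fun x => x) α β) : α = β := by
  have h1 := h.eq_map (g := fun x => x) (fun _ _ _ _ e => e) fun _ _ => rfl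
  have h0 : IsIso (fun x => x) α α :=
    ⟨Set.bijOn_id _, fun _ _ _ _ => Iff.rfl, fun _ _ => rfl, fun _ _ => (Form.map_id _).symm⟩
  exact (h0.eq_map (fun _ _ _ _ e => e) fun _ _ => rfl).trans h1.symm

theorem Below.eq_of_iso (h : Below α β) (hi : Iso β α) : α = β :=
  (h.emb.isIso hi.choose_spec.emb).eq

end LPOF

namespace Pom

variable {V L : Type*} [PartialOrder L] [OrderBot L]

theorem mk_eq_iff {α β : LPOF V L} : mk α = mk β ↔ LPOF.Iso α β :=
  ⟨fun h => Quotient.exact h, fun h => Quotient.sound h⟩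

theorem exists_mk (A : Pom V L) : ∃ α, mk α = A := Quotient.exists_rep A

theorem mk_le_mk {α β : LPOF V L} : mk α ≤ mk β ↔ ∃ f, LPOF.Emb f α β := by
  constructor
  · intro h
    obtain ⟨α', hα', hb⟩ := h β rfl
    obtain ⟨f, hf⟩ := mk_eq_iff.1 (Eq.symm hα' : mk α = mk α')
    exact ⟨f, hb.emb.comp hf.emb⟩
  · rintro ⟨f, hf⟩
    have hi := LPOF.isIso_map hf.injOn
    refine (le_iff_exists _ _).2 ⟨α.map f hf.injOn, (mk_eq_iff.2 ⟨f, hi⟩).symm, β, rfl,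
      LPOF.Emb.below ?_⟩
    have hn : (fun x => x) '' (α.map f hf.injOn).nodes = f '' α.nodes := Set.image_id' _
    refine ⟨?_, fun _ _ _ _ e => e, ?_, ?_, ?_, ?_, ?_⟩
    · rintro _ ⟨x, hx, rfl⟩
      exact hf.mapsTo hx
    · rintro _ ⟨x, hx, rfl⟩ _ ⟨y, hy, rfl⟩
      rw [← hi.lt_iff x hx y hy, hf.lt_iff x hx y hy]
    · rintro _ ⟨x, hx, rfl⟩ y hy
      rw [hn]
      exact hf.down x hx y hy
    · rintro _ ⟨x, hx, rfl⟩
      rw [hi.label_eq x hx]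
      exact hf.label_le x hx
    · rintro _ ⟨x, hx, rfl⟩
      rw [hi.form_eq x hx, Form.map_id, hf.form_eq x hx]
    · intro y hy hny
      rw [hn] at hny
      obtain ⟨z, hz, hzb, hzy⟩ := hf.bot_lt y hy hny
      exact ⟨f z, ⟨z, hz, rfl⟩, (hi.label_eq z hz).trans hzb, hzy⟩

instance : PartialOrder (Pom V L) where
  le_refl A := by
    obtain ⟨α, rfl⟩ := exists_mk A
    obtain ⟨f, hf⟩ := LPOF.Iso.refl α
    exact mk_le_mk.2 ⟨f, hf.emb⟩
  le_trans A B C hAB hBC := by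
    obtain ⟨α, rfl⟩ := exists_mk A
    obtain ⟨β, rfl⟩ := exists_mk B
    obtain ⟨γ, rfl⟩ := exists_mk C
    obtain ⟨f, hf⟩ := mk_le_mk.1 hAB
    obtain ⟨g, hg⟩ := mk_le_mk.1 hBC
    exact mk_le_mk.2 ⟨_, hg.comp hf⟩
  le_antisymm A B hAB hBA := by
    obtain ⟨α, rfl⟩ := exists_mk A
    obtain ⟨β, rfl⟩ := exists_mk B
    obtain ⟨f, hf⟩ := mk_le_mk.1 hAB
    obtain ⟨g, hg⟩ := mk_le_mk.1 hBA
    exact mk_eq_iff.2 ⟨f, hf.isIso hg⟩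

end Pom

/-! ### Truncation -/

namespace LPOF

variable {V L : Type*} [PartialOrder L] [OrderBot L] {α β γ : LPOF V L} {f g : V → V}

open Classical in
/-- The truncation of `α` at level `n`: the nodes up to level `n`, where those on level `n` are
relabelled `⊥`. -/
noncomputable def trunc (n : ℕ) (α : LPOF V L) : LPOF V L where
  nodes := {x ∈ α.nodes | α.lev x ≤ n}
  lt x y := α.lt x y ∧ α.lev y ≤ n
  label x := if α.lev x < n then α.label x else ⊥
  form x := if α.lev x ≤ n then α.form x else Form.tru
  countable_nodes := (α.finite_lev_le n).countable
  lt_mem x y h := ⟨⟨(α.lt_mem _ _ h.1).1, (lev_lt_lev h.1).le.trans h.2⟩,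
    (α.lt_mem _ _ h.1).2, h.2⟩
  lt_irrefl x h := α.lt_irrefl x h.1
  lt_trans x y z h1 h2 := ⟨α.lt_trans _ _ _ h1.1 h2.1, h2.2⟩
  finite_predPlus x hx := (α.finite_predPlus x hx.1).subset fun y hy => hy.1
  finite_level k := (α.finite_lev_le n).subset fun x hx => hx.1
  single_root := by
    obtain ⟨r, hr, hroot⟩ := α.exists_root
    have h0 : ∀ y, ¬ α.lt y r := fun y hy => by
      rcases hroot y (α.lt_mem _ _ hy).1 with rfl | h
      · exact α.lt_irrefl _ hy
      · exact α.lt_irrefl _ (α.lt_trans _ _ _ hy h)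
    have hl : α.lev r ≤ n :=
      (α.isFinPrecOrder.level_eq_zero (α.isFinPrecOrder.mem_minNodes.2 ⟨hr, h0⟩)).trans_le
        (Nat.zero_le n)
    refine ⟨r, Set.eq_singleton_iff_unique_mem.2 ⟨⟨⟨hr, hl⟩, ?_⟩, fun x hx => ?_⟩⟩
    · exact Set.eq_empty_of_forall_notMem fun y hy => h0 y hy.1.1
    · by_contra hne
      have hrx := (hroot x hx.1.1).resolve_left (Ne.symm hne)
      obtain ⟨w, -, hw⟩ := α.isFinPrecOrder.exists_pred hrx
      have hwx : w ∈ pred (fun x y => α.lt x y ∧ α.lev y ≤ n) x :=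
        ⟨⟨hw.1, hx.1.2⟩, fun ⟨z, h1, h2⟩ => hw.2 ⟨z, h1.1, h2.1⟩⟩
      rw [hx.2] at hwx
      exact hwx
  succ_bot x hx hb := by
    refine Set.eq_empty_of_forall_notMem fun y hy => ?_
    have hxy := hy.1
    rw [if_pos ((lev_lt_lev hxy.1).trans_le hxy.2)] at hb
    exact label_ne_bot_of_lt hxy.1 hb
  form_sat x hx := by
    rw [if_pos hx.2]
    exact α.form_sat x hx.1
  form_free x hx := by
    rw [if_pos hx.2]
    exact fun y hy => ⟨α.form_free x hx.1 hy, hx.2⟩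
  form_entails x y h := by
    rw [if_pos h.2, if_pos ((lev_lt_lev h.1).le.trans h.2)]
    exact α.form_entails x y h.1
  label_outside x hx := by
    split_ifs with h
    · exact α.label_outside x fun hm => hx ⟨hm, h.le⟩
    · rfl
  form_outside x hx := by
    split_ifs with h
    · exact α.form_outside x fun hm => hx ⟨hm, h⟩
    · rfl

theorem trunc_label_of_lt {n : ℕ} {x : V} (h : α.lev x < n) : (α.trunc n).label x = α.label x :=
  if_pos h

theorem trunc_label_of_le {n : ℕ} {x : V} (h : n ≤ α.lev x) : (α.trunc n).label x = ⊥ :=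
  if_neg (not_lt.2 h)

theorem trunc_label_le (n : ℕ) (x : V) : (α.trunc n).label x ≤ α.label x := by
  rcases lt_or_ge (α.lev x) n with h | h
  · exact (trunc_label_of_lt h).le
  · exact (trunc_label_of_le h).trans_le bot_le

theorem trunc_form {n : ℕ} {x : V} (h : α.lev x ≤ n) : (α.trunc n).form x = α.form x :=
  if_pos h

theorem finite_trunc (n : ℕ) (α : LPOF V L) : (α.trunc n).nodes.Finite := α.finite_lev_le n

/-- Each node of `α` that is cut off lies above a node of level `n`, which the truncation
labels `⊥`. -/
theorem trunc_emb (n : ℕ) (α : LPOF V L) : Emb (fun x => x) (α.trunc n) α where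
  mapsTo _ hx := hx.1
  injOn _ _ _ _ e := e
  lt_iff _ _ _ hy := and_iff_left hy.2
  down x hx y hy := ⟨y, ⟨(α.lt_mem _ _ hy).1, (lev_lt_lev hy).le.trans hx.2⟩, rfl⟩
  label_le x _ := trunc_label_le n x
  form_eq x hx := by rw [Form.map_id, trunc_form hx.2]
  bot_lt y hy hn := by
    rw [Set.image_id'] at hn
    obtain ⟨z, hzy, hz⟩ := α.isFinPrecOrder.exists_lt_level_eq hy
      (not_le.1 fun h => hn ⟨hy, h⟩)
    exact ⟨z, ⟨(α.lt_mem _ _ hzy).1, hz.le⟩, trunc_label_of_le hz.ge, hzy⟩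

theorem lev_trunc {n : ℕ} {x : V} (hx : x ∈ α.nodes) (h : α.lev x ≤ n) :
    (α.trunc n).lev x = α.lev x :=
  ((trunc_emb n α).lev_eq (x := x) ⟨hx, h⟩).symm

theorem Emb.trunc (h : Emb f α β) (n : ℕ) : Emb f (α.trunc n) (β.trunc n) where
  mapsTo _ hx := ⟨h.mapsTo hx.1, (h.lev_eq hx.1).trans_le hx.2⟩
  injOn := h.injOn.mono fun _ hx => hx.1
  lt_iff x hx y hy := and_congr (h.lt_iff x hx.1 y hy.1) (by rw [h.lev_eq hy.1])
  down x hx y hy := by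
    obtain ⟨z, hz, rfl⟩ := h.down_lt hx.1 hy.1
    exact ⟨z, ⟨(α.lt_mem _ _ hz).1, (lev_lt_lev hz).le.trans hx.2⟩, rfl⟩
  label_le x hx := by
    rcases lt_or_ge (α.lev x) n with hl | hl
    · rw [trunc_label_of_lt hl, trunc_label_of_lt ((h.lev_eq hx.1).trans_lt hl)]
      exact h.label_le x hx.1
    · rw [trunc_label_of_le hl]
      exact bot_le
  form_eq x hx := by
    rw [trunc_form hx.2, trunc_form ((h.lev_eq hx.1).trans_le hx.2), h.form_eq x hx.1]
  bot_lt y hy hn := by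
    obtain ⟨z, hz, hzb, hzy⟩ := h.bot_lt y hy.1 fun ⟨x, hx, e⟩ =>
      hn ⟨x, ⟨hx, h.lev_eq hx ▸ e ▸ hy.2⟩, e⟩
    refine ⟨z, ⟨hz, ?_⟩, le_bot_iff.1 ((trunc_label_le n z).trans_eq hzb), hzy, hy.2⟩
    exact (h.lev_eq hz ▸ lev_lt_lev hzy).le.trans hy.2

theorem Iso.trunc (h : Iso α β) (n : ℕ) : Iso (α.trunc n) (β.trunc n) := by
  obtain ⟨f, hf⟩ := h
  obtain ⟨g, hg⟩ := Iso.symm ⟨f, hf⟩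
  exact ⟨f, (hf.emb.trunc n).isIso (hg.emb.trunc n)⟩

/-- It suffices to compare labels and formulae on the nodes. -/
theorem ext_nodes (hn : α.nodes = β.nodes) (hlt : ∀ x y, α.lt x y ↔ β.lt x y)
    (hl : ∀ x ∈ α.nodes, α.label x = β.label x) (hf : ∀ x ∈ α.nodes, α.form x = β.form x) :
    α = β := by
  refine LPOF.ext hn (by ext x y; exact hlt x y) ?_ ?_
  · funext x
    by_cases hx : x ∈ α.nodes
    · exact hl x hx
    · rw [α.label_outside x hx, β.label_outside x (hn ▸ hx)]
  · funext x
    by_cases hx : x ∈ α.nodes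
    · exact hf x hx
    · rw [α.form_outside x hx, β.form_outside x (hn ▸ hx)]

theorem trunc_trunc {m n : ℕ} (h : m ≤ n) (α : LPOF V L) : (α.trunc n).trunc m = α.trunc m := by
  have hlev : ∀ x ∈ α.nodes, α.lev x ≤ n → (α.trunc n).lev x = α.lev x := fun x hx hl =>
    lev_trunc hx hl
  have hn : ((α.trunc n).trunc m).nodes = (α.trunc m).nodes := by
    ext x
    constructor
    · rintro ⟨hx, hl⟩
      exact ⟨hx.1, hlev x hx.1 hx.2 ▸ hl⟩
    · rintro ⟨hx, hl⟩
      exact ⟨⟨hx, hl.trans h⟩, (hlev x hx (hl.trans h)).trans_le hl⟩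
  refine ext_nodes hn (fun x y => ?_) (fun x hx => ?_) fun x hx => ?_
  · constructor
    · rintro ⟨⟨hxy, hy⟩, hl⟩
      exact ⟨hxy, hlev y (α.lt_mem _ _ hxy).2 hy ▸ hl⟩
    · rintro ⟨hxy, hl⟩
      exact ⟨⟨hxy, hl.trans h⟩, (hlev y (α.lt_mem _ _ hxy).2 (hl.trans h)).trans_le hl⟩
  · obtain ⟨hx1, hx2⟩ := hn ▸ hx
    have e := hlev x hx1 (hx2.trans h)
    rcases lt_or_ge (α.lev x) m with hl | hl
    · rw [trunc_label_of_lt (e.trans_lt hl), trunc_label_of_lt hl,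
        trunc_label_of_lt (hl.trans_le h)]
    · rw [trunc_label_of_le (hl.trans_eq e.symm), trunc_label_of_le hl]
  · obtain ⟨hx1, hx2⟩ := hn ▸ hx
    rw [trunc_form hx.2, trunc_form (hx2.trans h), trunc_form hx2]

theorem exists_trunc_eq_self (h : α.nodes.Finite) : ∃ n, α.trunc n = α := by
  obtain ⟨n, hn⟩ := (h.image α.lev).bddAbove
  have hn' : ∀ x ∈ α.nodes, α.lev x < n + 1 := fun x hx =>
    Nat.lt_succ_of_le (hn ⟨x, hx, rfl⟩)
  refine ⟨n + 1, ext_nodes (Set.sep_eq_self_iff_mem_true.2 fun x hx => (hn' x hx).le)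
    (fun x y => and_iff_left_of_imp fun hxy => (hn' y (α.lt_mem _ _ hxy).2).le)
    (fun x hx => trunc_label_of_lt (hn' x hx.1)) fun x hx => trunc_form hx.2⟩

/-- Embeddings of all truncations of `α` into `β` yield an embedding of `α`. A node on level `k` is
sent to one of the finitely many nodes of `β` on level `k`, so the embeddings converge pointwise
along an ultrafilter. -/
theorem exists_emb_of_trunc {F : ℕ → V → V} (hF : ∀ n, Emb (F n) (α.trunc n) β) :
    ∃ f, Emb f α β := by
  have key : ∀ x ∈ α.nodes, ∃ y, ∀ᶠ n in (Filter.hyperfilter ℕ : Filter ℕ), F n x = y := by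
    intro x hx
    have hev : ∀ᶠ n in (Filter.hyperfilter ℕ : Filter ℕ),
        ∃ y ∈ {y ∈ β.nodes | β.lev y ≤ α.lev x}, F n x = y := by
      refine Filter.Eventually.filter_mono Nat.hyperfilter_le_atTop ?_
      filter_upwards [Filter.eventually_ge_atTop (α.lev x)] with n hn
      have hxn : x ∈ (α.trunc n).nodes := ⟨hx, hn⟩
      refine ⟨_, ⟨(hF n).mapsTo hxn, ?_⟩, rfl⟩
      rw [(hF n).lev_eq hxn, lev_trunc hx hn]
    rw [Ultrafilter.eventually_exists_mem_iff (β.finite_lev_le _)] at hev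
    obtain ⟨y, -, hy⟩ := hev
    exact ⟨y, hy⟩
  have : Nonempty V := ⟨α.exists_root.choose⟩
  choose! f hf using key
  have hfn : ∀ m, Emb f (α.trunc m) β := by
    intro m
    have h1 : ∀ᶠ n in (Filter.hyperfilter ℕ : Filter ℕ), ∀ x ∈ (α.trunc m).nodes, F n x = f x :=
      (Filter.eventually_all_finite (finite_trunc m α)).2 fun x hx => hf x hx.1
    have h2 : ∀ᶠ n in (Filter.hyperfilter ℕ : Filter ℕ), m ≤ n :=
      Filter.Eventually.filter_mono Nat.hyperfilter_le_atTop (Filter.eventually_ge_atTop m)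
    obtain ⟨n, hn, hmn⟩ := (h1.and h2).exists
    have h3 := trunc_emb m (α.trunc n)
    rw [trunc_trunc hmn] at h3
    exact ((hF n).comp h3).congr fun x hx => (hn x hx).symm
  have hmem : ∀ x ∈ α.nodes, ∀ n, α.lev x ≤ n → x ∈ (α.trunc n).nodes := fun x hx n hn => ⟨hx, hn⟩
  refine ⟨f, fun x hx => (hfn _).mapsTo (hmem x hx _ le_rfl), fun x hx y hy => ?_,
    fun x hx y hy => ?_, fun x hx y hy => ?_, fun x hx => ?_, fun x hx => ?_, fun y hy hn => ?_⟩
  · exact (hfn (max (α.lev x) (α.lev y))).injOn (hmem x hx _ (le_max_left _ _))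
      (hmem y hy _ (le_max_right _ _))
  · rw [← (hfn (max (α.lev x) (α.lev y))).lt_iff x (hmem x hx _ (le_max_left _ _)) y
      (hmem y hy _ (le_max_right _ _))]
    exact (and_iff_left (le_max_right _ _)).symm
  · obtain ⟨z, hz, e⟩ := (hfn _).down x (hmem x hx _ le_rfl) y hy
    exact ⟨z, hz.1, e⟩
  · have := (hfn (α.lev x + 1)).label_le x (hmem x hx _ (Nat.le_succ _))
    rwa [trunc_label_of_lt (Nat.lt_succ_self _)] at this
  · have := (hfn _).form_eq x (hmem x hx _ le_rfl)
    rwa [trunc_form le_rfl] at this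
  · -- truncating at the level of `y` puts the node labelled `⊥` strictly below the truncation
    -- level, so that it has this label already in `α`
    obtain ⟨z, hz, hzb, hzy⟩ := (hfn (β.lev y)).bot_lt y hy fun ⟨x, hx, e⟩ => hn ⟨x, hx.1, e⟩
    have hl : α.lev z < β.lev y := by
      have h1 := (hfn (β.lev y)).lev_eq hz
      rw [lev_trunc hz.1 hz.2] at h1
      exact h1 ▸ lev_lt_lev hzy
    exact ⟨z, hz.1, trunc_label_of_lt hl ▸ hzb, hzy⟩

end LPOF

/-! ### Chains of LPOFs -/

namespace LPOF

variable {V L : Type*} [PartialOrder L] [OrderBot L]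

open Filter in
/-- A sequence of LPOFs in which each is a truncation of the next is the sequence of truncations of
its union. -/
theorem exists_trunc_eq {δ : ℕ → LPOF V L} (h : ∀ n, (δ (n + 1)).trunc n = δ n) :
    ∃ μ : LPOF V L, ∀ n, μ.trunc n = δ n := by
  have htr : ∀ {m n}, m ≤ n → (δ n).trunc m = δ m := by
    intro m n hmn
    induction n, hmn using Nat.le_induction with
    | base => rw [← h m, trunc_trunc le_rfl]
    | succ n hmn ih => rw [← trunc_trunc hmn, h, ih]
  have hemb : ∀ {m n}, m ≤ n → Emb (fun x => x) (δ m) (δ n) := fun {m n} hmn =>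
    htr hmn ▸ trunc_emb m (δ n)
  have hlev : ∀ {m x}, x ∈ (δ m).nodes → (δ m).lev x ≤ m := by
    intro m x hx
    rw [← h m] at hx ⊢
    exact (lev_trunc hx.1 hx.2).trans_le hx.2
  have hlevel : ∀ {m n x}, x ∈ (δ m).nodes → x ∈ (δ n).nodes → (δ n).lev x = (δ m).lev x := by
    intro m n x hm hn
    rcases le_total m n with e | e
    · exact (hemb e).lev_eq hm
    · exact ((hemb e).lev_eq hn).symm
  have hmem : ∀ {m n x}, x ∈ (δ m).nodes → (δ m).lev x ≤ n → x ∈ (δ n).nodes := by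
    intro m n x hm hl
    rcases le_total m n with e | e
    · exact (hemb e).mapsTo hm
    · rw [← htr e]
      exact ⟨hm, hl⟩
  have hltm : ∀ {m n x y}, m ≤ n → (δ m).lt x y → (δ n).lt x y := fun {m n x y} e hxy =>
    ((hemb e).lt_iff x ((δ m).lt_mem _ _ hxy).1 y ((δ m).lt_mem _ _ hxy).2).1 hxy
  have hdown : ∀ {m n x y}, x ∈ (δ m).nodes → (δ n).lt y x → (δ m).lt y x := by
    intro m n x y hx hyx
    rcases le_total m n with e | e
    · obtain ⟨z, hz, rfl⟩ := (hemb e).down_lt hx hyx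
      exact hz
    · exact hltm e hyx
  have hlabel : ∀ x, ∃ l, ∀ᶠ n in atTop, (δ n).label x = l := by
    intro x
    by_cases hx : ∃ m, x ∈ (δ m).nodes
    · obtain ⟨m, hm⟩ := hx
      refine ⟨(δ (m + 1)).label x, eventually_atTop.2 ⟨m + 1, fun n hn => ?_⟩⟩
      have hl : (δ n).lev x < m + 1 := by
        rw [hlevel hm ((hemb ((Nat.le_succ m).trans hn)).mapsTo hm)]
        exact Nat.lt_succ_of_le (hlev hm)
      rw [← htr hn, trunc_label_of_lt hl]
    · exact ⟨⊥, Eventually.of_forall fun n => (δ n).label_outside x fun hn => hx ⟨n, hn⟩⟩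
  have hform : ∀ x, ∃ p, ∀ᶠ n in atTop, (δ n).form x = p := by
    intro x
    by_cases hx : ∃ m, x ∈ (δ m).nodes
    · obtain ⟨m, hm⟩ := hx
      refine ⟨(δ m).form x, eventually_atTop.2 ⟨m, fun n hn => ?_⟩⟩
      rw [(hemb hn).form_eq x hm, Form.map_id]
    · exact ⟨Form.tru, Eventually.of_forall fun n => (δ n).form_outside x fun hn => hx ⟨n, hn⟩⟩
  choose lab hlab using hlabel
  choose frm hfrm using hform
  have hnodes : ∀ {x}, (∃ m, x ∈ (δ m).nodes) → ∀ᶠ n in atTop, x ∈ (δ n).nodes :=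
    fun ⟨m, hm⟩ => eventually_atTop.2 ⟨m, fun n hn => (hemb hn).mapsTo hm⟩
  have hlt : ∀ {x y}, (∃ m, (δ m).lt x y) → ∀ᶠ n in atTop, (δ n).lt x y :=
    fun ⟨m, hm⟩ => eventually_atTop.2 ⟨m, fun n hn => hltm hn hm⟩
  have hP : IsFinPrecOrder {x | ∃ m, x ∈ (δ m).nodes} (fun x y => ∃ m, (δ m).lt x y) := by
    refine ⟨fun x y ⟨m, hm⟩ => ?_, fun x ⟨m, hm⟩ => (δ m).lt_irrefl x hm,
      fun x y z hxy hyz => ?_, fun x ⟨m, hm⟩ => ?_⟩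
    · exact ⟨⟨m, ((δ m).lt_mem _ _ hm).1⟩, ⟨m, ((δ m).lt_mem _ _ hm).2⟩⟩
    · obtain ⟨n, h1, h2⟩ := ((hlt hxy).and (hlt hyz)).exists
      exact ⟨n, (δ n).lt_trans _ _ _ h1 h2⟩
    · exact ((δ m).finite_predPlus x hm).subset fun y ⟨n, hn⟩ => hdown hm hn
  have hPlev : ∀ {m x}, x ∈ (δ m).nodes →
      level {x | ∃ m, x ∈ (δ m).nodes} (fun x y => ∃ m, (δ m).lt x y) x = (δ m).lev x := by
    intro m x hx
    exact (δ m).isFinPrecOrder.level_map hP (f := fun x => x) (fun x hx => ⟨m, hx⟩)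
      (fun x y hxy => ⟨m, hxy⟩) (fun x hx w ⟨n, hn⟩ => ⟨w, hdown hx hn, rfl⟩) hx
  -- the data of `δ n` at any given nodes are those of the union for all large `n`, so the axioms
  -- carry over
  let μ : LPOF V L :=
    { nodes := {x | ∃ m, x ∈ (δ m).nodes}
      lt := fun x y => ∃ m, (δ m).lt x y
      label := lab
      form := frm
      countable_nodes := by
        have : {x | ∃ m, x ∈ (δ m).nodes} = ⋃ m, (δ m).nodes := by ext; simp
        rw [this]
        exact Set.countable_iUnion fun m => (δ m).countable_nodes
      lt_mem := hP.mem
      lt_irrefl := hP.irrefl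
      lt_trans := hP.trans
      finite_predPlus := hP.finite
      finite_level := by
        intro k
        refine (finite_trunc k (δ (k + 1))).subset ?_
        rintro x ⟨⟨m, hm⟩, hx⟩
        rw [h k]
        exact hmem hm (hPlev hm ▸ hx.le)
      single_root := by
        obtain ⟨r, hr, hroot⟩ := (δ 0).exists_root
        have hmin : ∀ y n, ¬ (δ n).lt y r := by
          intro y n hy
          have hy0 := hdown hr hy
          rcases hroot y ((δ 0).lt_mem _ _ hy0).1 with rfl | h
          · exact (δ 0).lt_irrefl _ hy0
          · exact (δ 0).lt_irrefl _ ((δ 0).lt_trans _ _ _ hy0 h)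
        refine ⟨r, Set.eq_singleton_iff_unique_mem.2
          ⟨hP.mem_minNodes.2 ⟨⟨0, hr⟩, fun y ⟨n, hn⟩ => hmin y n hn⟩, fun x hx => ?_⟩⟩
        obtain ⟨⟨n, hn⟩, hx⟩ := hP.mem_minNodes.1 hx
        obtain ⟨r', -, hroot'⟩ := (δ n).exists_root
        have h1 := (hroot' x hn).resolve_right fun h => hx _ ⟨n, h⟩
        have h2 := (hroot' r ((hemb (Nat.zero_le n)).mapsTo hr)).resolve_right (hmin _ n)
        exact h1.symm.trans h2
      succ_bot := by
        intro x _ hb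
        refine Set.eq_empty_of_forall_notMem fun y hy => ?_
        obtain ⟨n, h1, h2⟩ := ((hlt hy.1).and (hlab x)).exists
        exact label_ne_bot_of_lt h1 (h2.trans hb)
      form_sat := by
        intro x hx
        obtain ⟨n, h1, h2⟩ := ((hnodes hx).and (hfrm x)).exists
        exact h2 ▸ (δ n).form_sat x h1
      form_free := by
        intro x hx
        obtain ⟨n, h1, h2⟩ := ((hnodes hx).and (hfrm x)).exists
        exact fun y hy => ⟨n, (δ n).form_free x h1 (h2.symm ▸ hy)⟩
      form_entails := by
        intro x y hxy
        obtain ⟨n, h1, h2, h3⟩ := ((hlt hxy).and ((hfrm x).and (hfrm y))).exists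
        exact h2 ▸ h3 ▸ (δ n).form_entails x y h1
      label_outside := by
        intro x hx
        obtain ⟨n, hn⟩ := (hlab x).exists
        exact hn ▸ (δ n).label_outside x fun h => hx ⟨n, h⟩
      form_outside := by
        intro x hx
        obtain ⟨n, hn⟩ := (hfrm x).exists
        exact hn ▸ (δ n).form_outside x fun h => hx ⟨n, h⟩ }
  have hμlev : ∀ {m x}, x ∈ (δ m).nodes → μ.lev x = (δ m).lev x := hPlev
  refine ⟨μ, fun n => ?_⟩
  have hn : (μ.trunc n).nodes = (δ n).nodes := by
    ext x
    constructor
    · rintro ⟨⟨m, hm⟩, hl⟩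
      exact hmem hm (hμlev hm ▸ hl)
    · exact fun hx => ⟨⟨n, hx⟩, hμlev hx ▸ hlev hx⟩
  refine ext_nodes hn (fun x y => ?_) (fun x hx => ?_) fun x hx => ?_
  · constructor
    · rintro ⟨⟨m, hm⟩, hl⟩
      have hy := ((δ m).lt_mem _ _ hm).2
      exact hdown (hmem hy (hμlev hy ▸ hl)) hm
    · intro hxy
      have hy := ((δ n).lt_mem _ _ hxy).2
      exact ⟨⟨n, hxy⟩, hμlev hy ▸ hlev hy⟩
  · have hx' : x ∈ (δ n).nodes := hn ▸ hx
    obtain ⟨k, hk, hnk⟩ := ((hlab x).and (eventually_ge_atTop n)).exists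
    have hxk := (hemb hnk).mapsTo hx'
    rw [← htr hnk]
    rcases lt_or_ge ((δ k).lev x) n with hl | hl
    · rw [trunc_label_of_lt hl, trunc_label_of_lt ((hμlev hxk).trans_lt hl)]
      exact hk.symm
    · rw [trunc_label_of_le hl, trunc_label_of_le (hl.trans_eq (hμlev hxk).symm)]
  · have hx' : x ∈ (δ n).nodes := hn ▸ hx
    obtain ⟨k, hk, hnk⟩ := ((hfrm x).and (eventually_ge_atTop n)).exists
    rw [trunc_form hx.2, ← Form.map_id ((δ n).form x), ← (hemb hnk).form_eq x hx']
    exact hk.symm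

open Filter in
/-- Along a chain of LPOFs each truncation becomes constant: once the nodes below level `n` and
their labels are fixed, a new node on level `n` would have to lie above a node labelled `⊥` that
keeps this label, which is impossible. Then the finitely many labels on level `n` become fixed. -/
theorem exists_forall_trunc_eq [WellFoundedGT L] {γ : ℕ → LPOF V L}
    (h : ∀ i, Below (γ i) (γ (i + 1))) (n : ℕ) :
    ∃ i, ∀ j, i ≤ j → (γ j).trunc n = (γ i).trunc n := by
  have hemb : ∀ {i j}, i ≤ j → Emb (fun x => x) (γ i) (γ j) := by
    intro i j hij
    induction j, hij using Nat.le_induction with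
    | base => exact ⟨fun _ hx => hx, fun _ _ _ _ e => e, fun _ _ _ _ => Iff.rfl,
        fun x _ y hy => ⟨y, ((γ i).lt_mem _ _ hy).1, rfl⟩, fun _ _ => le_rfl,
        fun x _ => (Form.map_id _).symm, fun y hy hn => absurd ⟨y, hy, rfl⟩ hn⟩
    | succ j hij ih => exact (h j).emb.comp ih
  have hlabel : ∀ x, ∃ l, ∀ᶠ j in atTop, (γ j).label x = l := by
    intro x
    have hmono : Monotone fun j => (γ j).label x := by
      intro i j hij
      by_cases hx : x ∈ (γ i).nodes
      · exact (hemb hij).label_le x hx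
      · exact ((γ i).label_outside x hx).trans_le bot_le
    obtain ⟨k, hk⟩ := WellFoundedGT.monotone_chain_condition ⟨_, hmono⟩
    exact ⟨_, eventually_atTop.2 ⟨k, fun j hj => (hk j hj).symm⟩⟩
  choose lab hlab using hlabel
  -- nodes and labels below level `n` are fixed from some index on
  have key : ∀ n, ∃ i, ∀ j, i ≤ j → ∀ x ∈ (γ j).nodes, (γ j).lev x < n →
      x ∈ (γ i).nodes ∧ (γ j).label x = (γ i).label x := by
    intro n
    induction n with
    | zero => exact ⟨0, fun j _ x _ hl => absurd hl (Nat.not_lt_zero _)⟩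
    | succ n ih =>
      obtain ⟨i, hi⟩ := ih
      have hnode : ∀ j, i ≤ j → ∀ x ∈ (γ j).nodes, (γ j).lev x ≤ n → x ∈ (γ i).nodes := by
        intro j hij y hy hl
        by_contra hn
        obtain ⟨z, hz, hzb, hzy⟩ := (hemb hij).bot_lt y hy (by simpa using hn)
        have hzl := (hi j hij z ((hemb hij).mapsTo hz) ((lev_lt_lev hzy).trans_le hl)).2
        exact label_ne_bot_of_lt hzy (hzl.trans hzb)
      have hev : ∀ᶠ j in atTop, ∀ x ∈ {x ∈ (γ i).nodes | (γ i).lev x ≤ n},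
          (γ j).label x = lab x :=
        (eventually_all_finite ((γ i).finite_lev_le n)).2 fun x _ => hlab x
      obtain ⟨k, hk⟩ := eventually_atTop.1 hev
      refine ⟨max i k, fun j hj x hx hl => ?_⟩
      have hij := (le_max_left i k).trans hj
      have hxi := hnode j hij x hx (Nat.le_of_lt_succ hl)
      have hxm : x ∈ {x ∈ (γ i).nodes | (γ i).lev x ≤ n} :=
        ⟨hxi, (hemb hij).lev_eq hxi ▸ Nat.le_of_lt_succ hl⟩
      exact ⟨(hemb (le_max_left i k)).mapsTo hxi,
        (hk j ((le_max_right i k).trans hj) x hxm).trans (hk _ (le_max_right i k) x hxm).symm⟩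
  obtain ⟨i, hi⟩ := key (n + 1)
  refine ⟨i, fun j hij => ?_⟩
  have hlev : ∀ x ∈ (γ i).nodes, (γ j).lev x = (γ i).lev x := fun x hx => (hemb hij).lev_eq hx
  refine (ext_nodes ?_ (fun x y => ?_) (fun x hx => ?_) fun x hx => ?_).symm
  · ext x
    constructor
    · rintro ⟨hx, hl⟩
      exact ⟨(hemb hij).mapsTo hx, (hlev x hx).trans_le hl⟩
    · rintro ⟨hx, hl⟩
      have hxi := (hi j hij x hx (Nat.lt_succ_of_le hl)).1
      exact ⟨hxi, hlev x hxi ▸ hl⟩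
  · constructor
    · rintro ⟨hxy, hl⟩
      have hm := (γ i).lt_mem _ _ hxy
      exact ⟨((hemb hij).lt_iff x hm.1 y hm.2).1 hxy, (hlev y hm.2).trans_le hl⟩
    · rintro ⟨hxy, hl⟩
      have hyi := (hi j hij y ((γ j).lt_mem _ _ hxy).2 (Nat.lt_succ_of_le hl)).1
      obtain ⟨z, hz, rfl⟩ := (hemb hij).down_lt hyi hxy
      exact ⟨hz, hlev y hyi ▸ hl⟩
  · have e := hlev x hx.1
    rcases lt_or_ge ((γ i).lev x) n with hl | hl
    · rw [trunc_label_of_lt hl, trunc_label_of_lt (e.trans_lt hl)]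
      have hl' := e.trans_lt (hl.trans (Nat.lt_succ_self n))
      exact (hi j hij x ((hemb hij).mapsTo hx.1) hl').2.symm
    · rw [trunc_label_of_le hl, trunc_label_of_le (hl.trans_eq e.symm)]
  · rw [trunc_form hx.2, trunc_form ((hlev x hx.1).trans_le hx.2), (hemb hij).form_eq x hx.1,
      Form.map_id]

end LPOF

/-- The supremum of an ascending sequence that does not stop would have infinitely many elements
below it. -/
theorem wellFoundedGT_of_isDcpo {L : Type*} [PartialOrder L] (hdcpo : IsDcpo L)
    (hfin : IsFinitelyPreceded L) : WellFoundedGT L := by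
  rw [wellFoundedGT_iff_monotone_chain_condition']
  intro a
  by_contra! hc
  obtain ⟨s, hs⟩ := hdcpo.2 (Set.range a) ⟨Set.range_nonempty a, by
    rintro _ ⟨i, rfl⟩ _ ⟨j, rfl⟩
    exact ⟨_, ⟨max i j, rfl⟩, a.monotone (le_max_left i j), a.monotone (le_max_right i j)⟩⟩
  have hmem : ∀ i, a i ∈ Set.Iio s := fun i =>
    have ⟨j, _, hlt⟩ := hc i
    hlt.trans_le (hs.1 ⟨j, rfl⟩)
  have hfr : (Set.range a).Finite := (hfin s).subset (by rintro _ ⟨i, rfl⟩; exact hmem i)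
  obtain ⟨_, ⟨⟨i, rfl⟩, hmax⟩⟩ := hfr.exists_maximal (Set.range_nonempty a)
  obtain ⟨j, _, hlt⟩ := hc i
  exact hlt.not_ge (hmax ⟨j, rfl⟩ hlt.le)

/-! ### Truncation of pomsets, and directed sets -/

namespace Pom

variable {V L : Type*} [PartialOrder L] [OrderBot L]

/-- The truncation of a pomset at level `n`. -/
noncomputable def trunc (n : ℕ) : Pom V L → Pom V L :=
  Quotient.map (LPOF.trunc n) fun _ _ h => LPOF.Iso.trunc h n

theorem trunc_mk (n : ℕ) (α : LPOF V L) : trunc n (mk α) = mk (α.trunc n) := rfl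

theorem trunc_le (n : ℕ) (A : Pom V L) : trunc n A ≤ A := by
  obtain ⟨α, rfl⟩ := exists_mk A
  exact mk_le_mk.2 ⟨_, LPOF.trunc_emb n α⟩

theorem trunc_mono (n : ℕ) : Monotone (trunc n : Pom V L → Pom V L) := by
  intro A B h
  obtain ⟨α, rfl⟩ := exists_mk A
  obtain ⟨β, rfl⟩ := exists_mk B
  obtain ⟨f, hf⟩ := mk_le_mk.1 h
  exact mk_le_mk.2 ⟨f, hf.trunc n⟩

theorem trunc_trunc {m n : ℕ} (h : m ≤ n) (A : Pom V L) : trunc m (trunc n A) = trunc m A := by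
  obtain ⟨α, rfl⟩ := exists_mk A
  rw [trunc_mk, trunc_mk, trunc_mk, LPOF.trunc_trunc h]

theorem trunc_le_trunc {m n : ℕ} (h : m ≤ n) (A : Pom V L) : trunc m A ≤ trunc n A :=
  trunc_trunc h A ▸ trunc_le m (trunc n A)

theorem mem_finitePomsets_iff {A : Pom V L} :
    A ∈ finitePomsets V L ↔ ∃ n, trunc n A = A := by
  constructor
  · rintro ⟨α, rfl, hα⟩
    obtain ⟨n, hn⟩ := LPOF.exists_trunc_eq_self hα
    exact ⟨n, by rw [trunc_mk, hn]⟩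
  · rintro ⟨n, hn⟩
    obtain ⟨α, rfl⟩ := exists_mk A
    exact ⟨α.trunc n, hn, LPOF.finite_trunc n α⟩

theorem trunc_mem_finitePomsets (n : ℕ) (A : Pom V L) : trunc n A ∈ finitePomsets V L :=
  mem_finitePomsets_iff.2 ⟨n, trunc_trunc le_rfl A⟩

theorem finite_nodes_of_mk_mem {α : LPOF V L} (h : mk α ∈ finitePomsets V L) :
    α.nodes.Finite := by
  obtain ⟨β, hβ, hfin⟩ := h
  obtain ⟨f, hf⟩ := mk_eq_iff.1 (hβ : mk β = mk α)
  exact hf.bijOn.finite_iff_finite.1 hfin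

theorem mem_finitePomsets_of_le {A B : Pom V L} (h : A ≤ B) (hB : B ∈ finitePomsets V L) :
    A ∈ finitePomsets V L := by
  obtain ⟨α, rfl⟩ := exists_mk A
  obtain ⟨β, rfl⟩ := exists_mk B
  obtain ⟨f, hf⟩ := mk_le_mk.1 h
  exact ⟨α, rfl, .of_injOn hf.mapsTo hf.injOn (finite_nodes_of_mk_mem hB)⟩

/-- A pomset is the least upper bound of its truncations. This is where compactness enters, through
`LPOF.exists_emb_of_trunc`. -/
theorem le_of_forall_trunc_le {A B : Pom V L} (h : ∀ n, trunc n A ≤ B) : A ≤ B := by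
  obtain ⟨α, rfl⟩ := exists_mk A
  obtain ⟨β, rfl⟩ := exists_mk B
  choose F hF using fun n => mk_le_mk.1 (h n)
  exact mk_le_mk.2 (LPOF.exists_emb_of_trunc hF)

/-- An ascending sequence of finite pomsets has representatives each of which lies below the next.
This needs fresh nodes for the representatives, hence an infinite universe. -/
theorem exists_chain [Infinite V] {C : ℕ → Pom V L} (hC : ∀ i, C i ∈ finitePomsets V L)
    (hle : ∀ i, C i ≤ C (i + 1)) :
    ∃ γ : ℕ → LPOF V L, (∀ i, mk (γ i) = C i) ∧ ∀ i, LPOF.Below (γ i) (γ (i + 1)) := by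
  have hstep : ∀ i (α : {α : LPOF V L // mk α = C i}),
      ∃ β : {β : LPOF V L // mk β = C (i + 1)}, LPOF.Below α.1 β.1 := by
    rintro i ⟨α, hα⟩
    have hinf : ∀ α ∈ C i, (α.nodesᶜ).Infinite := fun α (hα : mk α = C i) =>
      (finite_nodes_of_mk_mem (hα ▸ hC i)).infinite_compl
    obtain ⟨β, hβ, hb⟩ := (le_iff_forall_exists _ _ hinf).1 (hle i) α hα
    exact ⟨⟨β, hβ⟩, hb⟩
  choose next hnext using hstep
  let γ : ∀ i, {α : LPOF V L // mk α = C i} :=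
    fun i => Nat.rec ⟨(exists_mk (C 0)).choose, (exists_mk (C 0)).choose_spec⟩ next i
  exact ⟨fun i => (γ i).1, fun i => (γ i).2, fun i => hnext i (γ i)⟩

/-- Pomsets form the inverse limit of their truncations. -/
theorem exists_trunc_eq [Infinite V] {D : ℕ → Pom V L} (h : ∀ n, trunc n (D (n + 1)) = D n) :
    ∃ M : Pom V L, ∀ n, trunc n M = D n := by
  obtain ⟨γ, hγ, hb⟩ := exists_chain (fun n => h n ▸ trunc_mem_finitePomsets n (D (n + 1)))
    fun n => (h n).symm.trans_le (trunc_le n _)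
  have hn : ∀ n, (γ n).trunc n = γ n := fun n => by
    refine (LPOF.trunc_emb n (γ n)).below.eq_of_iso (mk_eq_iff.1 ?_)
    rw [← trunc_mk, hγ, ← h n, trunc_trunc le_rfl]
  obtain ⟨μ, hμ⟩ := LPOF.exists_trunc_eq (δ := γ) fun n => by
    have he := (hb n).emb.trunc n
    rw [hn n] at he
    refine (he.below.eq_of_iso (mk_eq_iff.1 ?_)).symm
    rw [← trunc_mk, hγ, hγ, h n]
  exact ⟨mk μ, fun n => by rw [trunc_mk, hμ, hγ]⟩

theorem isLUB_finApprox (A : Pom V L) : IsLUB (finApprox A) A :=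
  ⟨fun _ hB => hB.2, fun _ hU => le_of_forall_trunc_le fun n =>
    hU ⟨trunc_mem_finitePomsets n A, trunc_le n A⟩⟩

theorem isDirectedSet_finApprox (A : Pom V L) : IsDirectedSet (finApprox A) := by
  refine ⟨⟨_, trunc_mem_finitePomsets 0 A, trunc_le 0 A⟩, fun B hB C hC => ?_⟩
  obtain ⟨m, hm⟩ := mem_finitePomsets_iff.1 hB.1
  obtain ⟨n, hn⟩ := mem_finitePomsets_iff.1 hC.1
  refine ⟨trunc (max m n) A, ⟨trunc_mem_finitePomsets _ A, trunc_le _ A⟩, ?_, ?_⟩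
  · exact (hm.symm.trans_le (trunc_mono m hB.2)).trans (trunc_le_trunc (le_max_left m n) A)
  · exact (hn.symm.trans_le (trunc_mono n hC.2)).trans (trunc_le_trunc (le_max_right m n) A)

variable [Infinite V] [WellFoundedGT L] {S : Set (Pom V L)}

/-- On a directed set each truncation is constant from some element on. -/
theorem exists_forall_trunc_eq (hS : S.Nonempty) (n : ℕ) :
    ∃ A ∈ S, ∀ B ∈ S, A ≤ B → trunc n B = trunc n A := by
  by_contra! hc
  obtain ⟨A₀, hA₀⟩ := hS
  have : Nonempty (Pom V L) := ⟨A₀⟩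
  choose! next hmem hle hne using hc
  have hit : ∀ i, next^[i] A₀ ∈ S := by
    intro i
    induction i with
    | zero => exact hA₀
    | succ i ih =>
      rw [Function.iterate_succ_apply']
      exact hmem _ ih
  obtain ⟨γ, hγ, hb⟩ := exists_chain (C := fun i => trunc n (next^[i] A₀))
    (fun i => trunc_mem_finitePomsets n _) fun i => by
      rw [Function.iterate_succ_apply']
      exact trunc_mono n (hle _ (hit i))
  obtain ⟨i, hi⟩ := LPOF.exists_forall_trunc_eq hb n
  have h1 := congrArg mk (hi (i + 1) (Nat.le_succ i))
  rw [← trunc_mk, ← trunc_mk, hγ, hγ, trunc_trunc le_rfl, trunc_trunc le_rfl,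
    Function.iterate_succ_apply'] at h1
  exact hne _ (hit i) h1

/-- A directed set of pomsets has a supremum, each truncation of which lies below an element of the
set. -/
theorem exists_isLUB (hS : IsDirectedSet S) :
    ∃ M, IsLUB S M ∧ ∀ n, ∃ A ∈ S, trunc n M ≤ A := by
  choose A hAS hA using exists_forall_trunc_eq hS.1
  obtain ⟨M, hM⟩ := exists_trunc_eq (D := fun n => trunc n (A n)) fun n => by
    obtain ⟨B, hB, h1, h2⟩ := hS.2 (A n) (hAS n) (A (n + 1)) (hAS (n + 1))
    rw [← hA _ B hB h2, trunc_trunc (Nat.le_succ n), hA _ B hB h1]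
  have hMA : ∀ n, trunc n M ≤ A n := fun n => (hM n).trans_le (trunc_le n _)
  -- `M` lies above `B`, as each truncation of `B` is below that of a common upper bound with `A n`
  refine ⟨M, ⟨fun B hB => le_of_forall_trunc_le fun n => ?_,
    fun U hU => le_of_forall_trunc_le fun n => (hMA n).trans (hU (hAS n))⟩,
    fun n => ⟨A n, hAS n, hMA n⟩⟩
  obtain ⟨C, hC, h1, h2⟩ := hS.2 B hB (A n) (hAS n)
  calc trunc n B ≤ trunc n C := trunc_mono n h1
    _ = trunc n M := (hA n C hC h2).trans (hM n).symm
    _ ≤ M := trunc_le n M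

/-- If a finite `A` lies below the supremum `M` of a directed set, then
`A = trunc n A ≤ trunc n M` for some `n`, and an element of the set lies above `trunc n M`. -/
theorem wayBelow_iff {A B : Pom V L} : WayBelow A B ↔ A ∈ finApprox B := by
  constructor
  · intro h
    obtain ⟨C, hC, hAC⟩ := h _ (isDirectedSet_finApprox B) B (isLUB_finApprox B) le_rfl
    exact ⟨mem_finitePomsets_of_le hAC hC.1, hAC.trans hC.2⟩
  · rintro ⟨hA, hAB⟩ S hS s hs hBs
    obtain ⟨M, hM, hT⟩ := exists_isLUB hS
    obtain ⟨n, hn⟩ := mem_finitePomsets_iff.1 hA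
    obtain ⟨C, hC, hle⟩ := hT n
    refine ⟨C, hC, ?_⟩
    calc A = trunc n A := hn.symm
      _ ≤ trunc n M := trunc_mono n ((hAB.trans hBs).trans (hs.2 hM.1))
      _ ≤ C := hle

theorem compactElements_eq : compactElements (Pom V L) = finitePomsets V L :=
  Set.ext fun _ => wayBelow_iff.trans (and_iff_left le_rfl)

theorem isAlgebraicDcpo : IsAlgebraicDcpo (Pom V L) := by
  refine ⟨⟨inferInstance, fun S hS => (exists_isLUB hS).imp fun _ h => h.1⟩, fun A => ?_⟩
  rw [compactElements_eq]
  exact ⟨isDirectedSet_finApprox A, isLUB_finApprox A⟩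

end Pom

end Pomset

theorem mainTheorem5 {V L : Type*} [Infinite V] [PartialOrder L] [OrderBot L]
    (hdcpo : Pomset.IsDcpo L) (hfin : Pomset.IsFinitelyPreceded L) :
    (∀ A : Pomset.Pom V L, IsLUB (Pomset.Pom.finApprox A) A) ∧
    Pomset.compactElements (Pomset.Pom V L) = Pomset.Pom.finitePomsets V L ∧
    (∀ A B : Pomset.Pom V L, Pomset.WayBelow A B ↔ A ∈ Pomset.Pom.finApprox B) ∧
    Pomset.IsAlgebraicDcpo (Pomset.Pom V L) := by
  have := Pomset.wellFoundedGT_of_isDcpo hdcpo hfin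
  exact ⟨Pomset.Pom.isLUB_finApprox, Pomset.Pom.compactElements_eq,
    fun _ _ => Pomset.Pom.wayBelow_iff, Pomset.Pom.isAlgebraicDcpo⟩
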